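/- Let $p$ be a prime number, let $k$ be an arbitrary field of characteristic $p$, let $n\ge 0$ and $\boldsymbol t=(t_1,\ldots,t_n)$, and let $G$ be a subgroup of $\mathbb Z^n$ such that $\mathbb Z^n/G$ has no torsion. Let $G_{\mathbb R}$ be the vector subspace of $\mathbb R^n$ generated by $G$, and let $\pi_G:\mathbb R^{n+1}=\mathbb R^n\times\mathbb R\to(\mathbb R^n/G_{\mathbb R})\times\mathbb R$ be the canonical projection. Let $K_{0,G}$ be the subfield of $k(\boldsymbol t)$ generated by $k$ and the monomials $\boldsymbol t^{\boldsymbol i}$, $\boldsymbol i\in G$. For $f=\sum_{\boldsymbol i\in\mathbb N^n}a(\boldsymbol i)\boldsymbol t^{\boldsymbol i}\in k[\![\boldsymbol t]\!]$, let $\Delta_G(f)=\sum_{\boldsymbol i\in G\cap\mathbb N^n}a(\boldsymbol i)\boldsymbol t^{\boldsymbol i}$ be its $G$-diagonal. Let $A(\boldsymbol t,y)\in k[\boldsymbol t,y]$ be a nonzero polynomial and let $f\in k[\![\boldsymbol t]\!]$ satisfy $A(\boldsymbol t,f)=0$. Let $\mathrm{NP}(A)\subset\mathbb R^{n+1}$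 be the Newton polytope of $A$, i.e. the convex hull of the exponents $(\boldsymbol i,j)$ of the monomials $\boldsymbol t^{\boldsymbol i}y^j$ with nonzero coefficient in $A$, and let $$C=\mathrm{NP}(A)+\big(G_{\mathbb R}\times(-1,0]\big)\subset\mathbb R^{n+1}$$ (Minkowski sum). Then the set $\pi_G(C\cap\mathbb N^{n+1})$ is finite and, writing $N$ for its cardinality, $\Delta_G(f)$ is annihilated (in the fraction field of $k[\![\boldsymbol t]\!]$, which contains $k(\boldsymbol t)$) by a linearized polynomial with coefficients in $K_{0,G}$ of $p$-degree at most $N$, that is, by a polynomial of the form $$c_0X+c_1X^p+\cdots+c_dX^{p^d},\qquad c_0,\ldots,c_d\in K_{0,G},\quad c_d\neq0,\quad d\le N.$$ -/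

import Mathlib

open scoped Pointwise

noncomputable section

namespace GenDiag

/-- The exponent `i ∈ ℕⁿ` viewed in `ℤⁿ`. -/
def toInt {n : ℕ} (i : Fin n →₀ ℕ) : Fin n → ℤ := fun j => (i j : ℤ)

/-- The exponent `i ∈ ℕⁿ` viewed in `ℝⁿ`. -/
def toReal {n : ℕ} (i : Fin n →₀ ℕ) : Fin n → ℝ := fun j => (i j : ℝ)

theorem toInt_zero {n : ℕ} : toInt (0 : Fin n →₀ ℕ) = 0 := by
  funext j; simp [toInt]

theorem toInt_add {n : ℕ} (a b : Fin n →₀ ℕ) : toInt (a + b) = toInt a + toInt b := by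
  funext j; simp [toInt]

section Fields

variable (k : Type*) [Field k] (n : ℕ)

/-- The field of rational functions `K₀ = k(t₁, …, tₙ)`. -/
abbrev K0 : Type _ := FractionRing (MvPolynomial (Fin n) k)

/-- The fraction field `K` of the power series ring `R = k⟦t₁, …, tₙ⟧`. -/
abbrev K : Type _ := FractionRing (MvPowerSeries (Fin n) k)

instance isDomain_mvPowerSeries : IsDomain (MvPowerSeries (Fin n) k) :=
  NoZeroDivisors.to_isDomain _

theorem algebraMap_polynomial_injective :
    Function.Injective
      (algebraMap (MvPolynomial (Fin n) k) (MvPowerSeries (Fin n) k)) := by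
  intro a b h
  simpa [MvPowerSeries.algebraMap_apply'] using h

/-- The canonical inclusion of `k(t)` in `K`, induced by `k[t] ⊆ k⟦t⟧`. -/
def inclusionK0 : K0 k n →+* K k n :=
  IsFractionRing.map (algebraMap_polynomial_injective k n)

variable {n}

/-- The Laurent monomial `t ^ i` for `i ∈ ℤⁿ`, as an element of `k(t)`. -/
def laurentMonomial (i : Fin n → ℤ) : K0 k n :=
  ∏ j, (algebraMap (MvPolynomial (Fin n) k) (K0 k n) (MvPolynomial.X j)) ^ (i j)

/-- The subfield of `k(t)` generated by `k` and by the monomials `t ^ i`, `i ∈ G`. -/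
def K0G (G : AddSubgroup (Fin n → ℤ)) : IntermediateField k (K0 k n) :=
  IntermediateField.adjoin k (laurentMonomial k '' (G : Set (Fin n → ℤ)))

/-- The `k`-subalgebra of `k⟦t⟧` of the power series supported on `G`. -/
def RG (G : AddSubgroup (Fin n → ℤ)) : Subalgebra k (MvPowerSeries (Fin n) k) where
  carrier := {f | ∀ i, MvPowerSeries.coeff i f ≠ 0 → toInt i ∈ G}
  mul_mem' := by
    classical
    intro f g hf hg i hi
    rw [MvPowerSeries.coeff_mul] at hi
    obtain ⟨x, hx, hne⟩ := Finset.exists_ne_zero_of_sum_ne_zero hi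
    rw [← Finset.HasAntidiagonal.mem_antidiagonal.mp hx, toInt_add]
    exact G.add_mem (hf _ (left_ne_zero_of_mul hne)) (hg _ (right_ne_zero_of_mul hne))
  add_mem' := by
    intro f g hf hg i hi
    by_cases h : MvPowerSeries.coeff i f = 0
    · refine hg i fun h' => hi ?_
      rw [map_add, h, h', add_zero]
    · exact hf i h
  algebraMap_mem' := by
    classical
    intro r i hi
    rw [MvPowerSeries.algebraMap_apply, MvPowerSeries.coeff_C] at hi
    by_cases h : i = 0
    · rw [h, toInt_zero]
      exact G.zero_mem
    · simp [h] at hi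

open Classical in
/-- The `G`-diagonal `Δ_G : k⟦t⟧ → R_G`, sending `∑ a(i) t ^ i` to the sum of its terms
with `i ∈ G`. -/
def diagonal (G : AddSubgroup (Fin n → ℤ)) (f : MvPowerSeries (Fin n) k) : RG k G :=
  ⟨fun i => if toInt i ∈ G then MvPowerSeries.coeff i f else 0, by
    intro i hi
    by_contra h
    exact hi (if_neg h)⟩

variable {k}

/-- The Newton polytope of `A ∈ k[t][y]`: the convex hull in `ℝⁿ × ℝ` of the exponents
`(i, j)` of the monomials `t ^ i y ^ j` with nonzero coefficient in `A`. -/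
def newtonPolytope (A : Polynomial (MvPolynomial (Fin n) k)) : Set ((Fin n → ℝ) × ℝ) :=
  convexHull ℝ
    {x | ∃ (i : Fin n →₀ ℕ) (j : ℕ), (A.coeff j).coeff i ≠ 0 ∧ x = (toReal i, (j : ℝ))}

end Fields

section Convex

variable {n : ℕ}

/-- `G_ℝ`: the real vector subspace of `ℝⁿ` generated by `G`. -/
def realSpan (G : AddSubgroup (Fin n → ℤ)) : Submodule ℝ (Fin n → ℝ) :=
  Submodule.span ℝ ((fun (g : Fin n → ℤ) (j : Fin n) => (g j : ℝ)) '' (G : Set (Fin n → ℤ)))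

/-- The canonical projection `π_G : ℝⁿ × ℝ → (ℝⁿ / G_ℝ) × ℝ`. -/
def proj (G : AddSubgroup (Fin n → ℤ)) :
    ((Fin n → ℝ) × ℝ) →ₗ[ℝ] (((Fin n → ℝ) ⧸ realSpan G) × ℝ) :=
  LinearMap.prodMap (realSpan G).mkQ LinearMap.id

/-- The set `ℕⁿ⁺¹ = ℕⁿ × ℕ` inside `ℝⁿ × ℝ`. -/
def natPoints (n : ℕ) : Set ((Fin n → ℝ) × ℝ) :=
  {x | ∃ (i : Fin n →₀ ℕ) (j : ℕ), x = (toReal i, (j : ℝ))}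

/-- The convex set `C = NP(A) + (G_ℝ × (-1, 0])` (Minkowski sum). -/
def convexC {k : Type*} [Field k] (G : AddSubgroup (Fin n → ℤ))
    (A : Polynomial (MvPolynomial (Fin n) k)) : Set ((Fin n → ℝ) × ℝ) :=
  newtonPolytope A + (realSpan G : Set (Fin n → ℝ)) ×ˢ Set.Ioc (-1 : ℝ) 0

end Convex

/-- `P` is a linearized polynomial of `p`-degree `d`: it is of the form
`c₀ X + c₁ X ^ p + ⋯ + c_d X ^ (p ^ d)` with `c_d ≠ 0`. -/
def IsLinearized {L : Type*} [Field L] (p : ℕ) (P : Polynomial L) (d : ℕ) : Prop :=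
  ∃ c : ℕ → L, c d ≠ 0 ∧
    P = ∑ s ∈ Finset.range (d + 1), Polynomial.C (c s) * Polynomial.X ^ (p ^ s)

end GenDiag

end

open scoped Pointwise

noncomputable section

namespace GenDiag

/-! Suppose first that `k` is perfect, that `A'(f) ≠ 0`, and that some `g₀ ∈ G ∩ ℕⁿ` is positive at
every coordinate where an element of `G` can be nonzero. Consider the series `g = P(f) / A'(f)`, the
residues at `y = f` of `P dy / A`, where `P` has its exponents in a set `X` containing those of `A`.
The series `f` is one of them, with `P = y A'`. Since `P / A = P A ^ (p - 1) / A ^ p` and residues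
commute with the Cartier operator, the section `S_u(g)` has the same form, its numerator being
extracted from `P A ^ (p - 1)` at the exponents `p j + p - 1` in `y` and `p i + u` in `t`
(`eval_cartier_mul_pow`).

The set `C` is designed to be stable under this process (`pt_add_mem_convexC`): a point of `C` plus
a point of `(p - 1) NP(A)`, lowered by `p - 1` in `y` and divided by `p`, is again in `C`, because
`NP(A)` is convex and `ε ↦ (ε - (p - 1)) / p` maps `(-1, 0]` into itself.

Next, `g = ∑ t ^ u S_u(g) ^ p`. The diagonal is linear over series supported on `G` and commutes
with the Frobenius. A term either dies or, when `u - p v ∈ G`, contributes `t ^ (u - p v) Δ(t ^ v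
S_u(g)) ^ p`. So, over the fractions of polynomials supported on `G`, the diagonals of these `g` lie
in the span of their own `p`-th powers. Moreover `A'(f) g` is a combination of monomials `t ^ i f ^
j`, one for each class modulo `G`, so these diagonals span dimension at most `N`. The `N + 1`
elements `Δ(f) ^ (p ^ s)`, `s ≤ N`, then lie in the span of at most `N` `p ^ N`-th powers, and are
dependent (`exists_linear_relation_pow`).

Three reductions lead to this case. Relations descend from an algebraic closure by applying a linear
form to the coefficients. Variables absent from `G ∩ ℕⁿ` are removed by passing to an initial form
of `A`. Finally `A` is replaced by an irreducible factor having `f` as a root, which is separable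
over a perfect field. The last two steps only translate exponents into `NP(A)`, by Ostrowski's
theorem for the factor (`pt_add_mem_newtonPolytope_mul`). -/

/-- The box `[0, p)ⁿ` of exponents. -/
def box (n p : ℕ) : Finset (Fin n →₀ ℕ) :=
  (Fintype.piFinset fun _ : Fin n => Finset.range p).map
    (Finsupp.equivFunOnFinite : (Fin n →₀ ℕ) ≃ (Fin n → ℕ)).symm.toEmbedding

theorem mem_box {n p : ℕ} {u : Fin n →₀ ℕ} : u ∈ box n p ↔ ∀ j, u j < p := by
  constructor
  · intro h j
    obtain ⟨v, hv, rfl⟩ := Finset.mem_map.mp h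
    simpa using Finset.mem_range.mp (Fintype.mem_piFinset.mp hv j)
  · intro h
    exact Finset.mem_map.mpr ⟨u, by simpa using h, by ext; rfl⟩

/-! ### Section operators on power series. -/

section Sections

variable {k : Type*} [Field k] {n : ℕ}

theorem coeff_algebraMap_mvPolynomial (a : MvPolynomial (Fin n) k) (i : Fin n →₀ ℕ) :
    MvPowerSeries.coeff i (algebraMap (MvPolynomial (Fin n) k) (MvPowerSeries (Fin n) k) a) =
      a.coeff i := by
  simp [MvPowerSeries.algebraMap_apply']

theorem exists_mvPolynomial_of_finite_support {h : MvPowerSeries (Fin n) k}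
    (hfin : {i | MvPowerSeries.coeff i h ≠ 0}.Finite) :
    ∃ b : MvPolynomial (Fin n) k,
      algebraMap (MvPolynomial (Fin n) k) (MvPowerSeries (Fin n) k) b = h := by
  classical
  refine ⟨∑ i ∈ hfin.toFinset, MvPolynomial.monomial i (MvPowerSeries.coeff i h), ?_⟩
  ext i
  rw [coeff_algebraMap_mvPolynomial, MvPolynomial.coeff_sum]
  simp only [MvPolynomial.coeff_monomial, Finset.sum_ite_eq', Set.Finite.mem_toFinset,
    Set.mem_ofPred_eq]
  split_ifs with h0
  · rfl
  · exact (not_not.mp h0).symm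

theorem coeff_pow_char_smul (p : ℕ) [Fact p.Prime] [CharP k p] (h : MvPowerSeries (Fin n) k)
    (i : Fin n →₀ ℕ) :
    MvPowerSeries.coeff (p • i) (h ^ p) = MvPowerSeries.coeff i h ^ p := by
  have hp : p ≠ 0 := (Fact.out : p.Prime).ne_zero
  rw [← MvPowerSeries.map_frobenius_expand p hp, MvPowerSeries.coeff_map,
    MvPowerSeries.coeff_expand_smul]
  rfl

theorem coeff_pow_char_of_not_dvd (p : ℕ) [Fact p.Prime] [CharP k p]
    (h : MvPowerSeries (Fin n) k) {x : Fin n →₀ ℕ} {j : Fin n} (hx : ¬ p ∣ x j) :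
    MvPowerSeries.coeff x (h ^ p) = 0 := by
  have hp : p ≠ 0 := (Fact.out : p.Prime).ne_zero
  rw [← MvPowerSeries.map_frobenius_expand p hp, MvPowerSeries.coeff_map,
    MvPowerSeries.coeff_expand_of_not_dvd p hp h hx, map_zero]

theorem exists_eq_smul_of_coeff_pow_char_ne_zero (p : ℕ) [Fact p.Prime] [CharP k p]
    {h : MvPowerSeries (Fin n) k} {x : Fin n →₀ ℕ} (hx : MvPowerSeries.coeff x (h ^ p) ≠ 0) :
    ∃ i, x = p • i := by
  have hd : ∀ j, p ∣ x j := fun j => by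
    by_contra hj
    exact hx (coeff_pow_char_of_not_dvd p h hj)
  refine ⟨x.mapRange (· / p) (Nat.zero_div p), ?_⟩
  ext j
  simp [Nat.mul_div_cancel' (hd j)]

theorem smul_injective_of_prime (p : ℕ) [Fact p.Prime] :
    Function.Injective fun i : Fin n →₀ ℕ => p • i := by
  intro a b h
  ext j
  have := DFunLike.congr_fun h j
  simpa [(Fact.out : p.Prime).ne_zero] using this

variable (p : ℕ) [Fact p.Prime] [CharP k p] [PerfectRing k p]

/-- The section operator `S_u`, taking `∑ a(i) t ^ i` to `∑ a(p i + u) ^ (1 / p) t ^ i`. -/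
def sectionOp (u : Fin n →₀ ℕ) : MvPowerSeries (Fin n) k →+ MvPowerSeries (Fin n) k where
  toFun h := fun i => (frobeniusEquiv k p).symm (MvPowerSeries.coeff (p • i + u) h)
  map_zero' := by
    ext i
    change (frobeniusEquiv k p).symm (MvPowerSeries.coeff (p • i + u) 0) = 0
    simp
  map_add' a b := by
    ext i
    change (frobeniusEquiv k p).symm (MvPowerSeries.coeff (p • i + u) (a + b)) =
      (frobeniusEquiv k p).symm (MvPowerSeries.coeff (p • i + u) a) +
        (frobeniusEquiv k p).symm (MvPowerSeries.coeff (p • i + u) b)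
    simp

theorem coeff_sectionOp (u : Fin n →₀ ℕ) (h : MvPowerSeries (Fin n) k) (i : Fin n →₀ ℕ) :
    MvPowerSeries.coeff i (sectionOp p u h) =
      (frobeniusEquiv k p).symm (MvPowerSeries.coeff (p • i + u) h) := rfl

theorem coeff_sectionOp_pow (u : Fin n →₀ ℕ) (h : MvPowerSeries (Fin n) k) (i : Fin n →₀ ℕ) :
    MvPowerSeries.coeff i (sectionOp p u h) ^ p = MvPowerSeries.coeff (p • i + u) h := by
  rw [coeff_sectionOp, ← frobenius_def, ← frobeniusEquiv_apply, RingEquiv.apply_symm_apply]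

/-- The exponents of `a ^ p` are multiples of `p`. As `u j < p` for all `j`, an equality `p • w + z
= p • i + u` forces `w ≤ i` and `z = p • (i - w) + u`, so only a copy of the antidiagonal of `i`
contributes. -/
theorem sectionOp_pow_mul (u : Fin n →₀ ℕ) (hu : ∀ j, u j < p) (a b : MvPowerSeries (Fin n) k) :
    sectionOp p u (a ^ p * b) = a * sectionOp p u b := by
  classical
  have hp : p ≠ 0 := (Fact.out : p.Prime).ne_zero
  refine MvPowerSeries.ext fun i => frobenius_inj k p ?_
  simp only [frobenius_def]
  rw [coeff_sectionOp_pow, MvPowerSeries.coeff_mul, MvPowerSeries.coeff_mul, sum_pow_char]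
  simp only [mul_pow, coeff_sectionOp_pow]
  symm
  apply Finset.sum_of_injOn (fun z => (p • z.1, p • z.2 + u))
  · rintro ⟨z1, z2⟩ - ⟨w1, w2⟩ - h
    simp only [Prod.mk.injEq, add_left_inj] at h
    exact Prod.ext (smul_injective_of_prime p h.1) (smul_injective_of_prime p h.2)
  · rintro ⟨z1, z2⟩ hz
    have hz' : z1 + z2 = i := by simpa using hz
    simp [← hz', add_assoc]
  · rintro ⟨z1, z2⟩ hz hn
    by_contra hne
    obtain ⟨w, rfl⟩ := exists_eq_smul_of_coeff_pow_char_ne_zero p (left_ne_zero_of_mul hne)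
    have hz' : p • w + z2 = p • i + u := by simpa using hz
    have hle : w ≤ i := by
      intro j
      have h1 := DFunLike.congr_fun hz' j
      simp only [Finsupp.coe_add, Finsupp.coe_smul, Pi.add_apply, Pi.smul_apply, smul_eq_mul] at h1
      have h2 := hu j
      by_contra hlt
      push Not at hlt
      have : p * (i j + 1) ≤ p * w j := Nat.mul_le_mul_left p hlt
      rw [mul_add] at this
      omega
    refine hn ⟨(w, i - w), ?_, ?_⟩
    · simpa using add_tsub_cancel_of_le hle
    · refine Prod.ext rfl ?_
      have h3 : p • w + z2 = p • w + (p • (i - w) + u) := by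
        rw [hz', ← add_assoc, ← smul_add, add_tsub_cancel_of_le hle]
      exact (add_left_cancel h3).symm
  · rintro ⟨z1, z2⟩ -
    rw [coeff_pow_char_smul]

theorem exists_mvPolynomial_sectionOp (u : Fin n →₀ ℕ) (a : MvPolynomial (Fin n) k) :
    ∃ b : MvPolynomial (Fin n) k,
      algebraMap (MvPolynomial (Fin n) k) (MvPowerSeries (Fin n) k) b =
        sectionOp p u (algebraMap (MvPolynomial (Fin n) k) (MvPowerSeries (Fin n) k) a) := by
  classical
  have hinj : Function.Injective fun i : Fin n →₀ ℕ => p • i + u := by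
    intro x y h
    exact smul_injective_of_prime p (add_right_cancel h)
  refine exists_mvPolynomial_of_finite_support ?_
  refine (a.support.finite_toSet.preimage hinj.injOn).subset fun i hi => ?_
  rw [Set.mem_preimage, Finset.mem_coe, MvPolynomial.mem_support_iff]
  intro h
  refine hi ?_
  rw [coeff_sectionOp, coeff_algebraMap_mvPolynomial, h, map_zero]

/-- Euclidean division of the exponents by `p`; the `p`-th power undoes the `p`-th roots taken in
`S_u`. -/
theorem eq_sum_monomial_mul_sectionOp_pow (f : MvPowerSeries (Fin n) k) :
    f = ∑ u ∈ box n p, MvPowerSeries.monomial u 1 * sectionOp p u f ^ p := by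
  classical
  have hp : 0 < p := (Fact.out : p.Prime).pos
  ext x
  rw [map_sum]
  let u : Fin n →₀ ℕ := x.mapRange (· % p) (Nat.zero_mod p)
  let i : Fin n →₀ ℕ := x.mapRange (· / p) (Nat.zero_div p)
  have hx : x = p • i + u := by
    ext j
    simp [u, i, Nat.div_add_mod]
  rw [Finset.sum_eq_single u]
  · conv_rhs => rw [hx, add_comm, MvPowerSeries.coeff_add_monomial_mul, one_mul,
      coeff_pow_char_smul, coeff_sectionOp_pow, ← hx]
  · intro v hv hne
    rw [mem_box] at hv
    rw [MvPowerSeries.coeff_monomial_mul]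
    split_ifs with hle
    · rw [one_mul]
      by_contra hc
      obtain ⟨w, hw⟩ := exists_eq_smul_of_coeff_pow_char_ne_zero p hc
      apply hne
      have hx' : x = p • w + v := by rw [← hw, tsub_add_cancel_of_le hle]
      ext j
      simp [u, hx', Nat.mod_eq_of_lt (hv j)]
    · rfl
  · intro hu
    exact absurd (mem_box.mpr fun j => by simpa [u] using Nat.mod_lt _ hp) hu

end Sections

/-! ### Linearity of the diagonal and compatibility with the Frobenius. -/

section Diagonal

variable {k : Type*} [Field k] {n : ℕ} (G : AddSubgroup (Fin n → ℤ))

open Classical in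
/-- The `G`-diagonal as an additive endomorphism of the ring of power series. -/
def diagHom : MvPowerSeries (Fin n) k →+ MvPowerSeries (Fin n) k where
  toFun f := (diagonal k G f : MvPowerSeries (Fin n) k)
  map_zero' := by
    ext i
    change (if toInt i ∈ G then _ else _) = _
    simp
  map_add' a b := by
    ext i
    change (if toInt i ∈ G then MvPowerSeries.coeff i (a + b) else 0) =
      (if toInt i ∈ G then MvPowerSeries.coeff i a else 0) +
        (if toInt i ∈ G then MvPowerSeries.coeff i b else 0)
    split_ifs <;> simp

open Classical in
theorem coeff_diagHom (f : MvPowerSeries (Fin n) k) (i : Fin n →₀ ℕ) :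
    MvPowerSeries.coeff i (diagHom G f) =
      if toInt i ∈ G then MvPowerSeries.coeff i f else 0 := rfl

theorem toInt_smul (m : ℕ) (i : Fin n →₀ ℕ) : toInt (m • i) = m • toInt i := by
  funext j; simp [toInt]

/-- Since `G` is a subgroup, the product of a term with exponent in `G` and another term has its
exponent in `G` exactly when the second does. -/
theorem diagHom_mul {c : MvPowerSeries (Fin n) k} (hc : c ∈ RG k G)
    (h : MvPowerSeries (Fin n) k) : diagHom G (c * h) = c * diagHom G h := by
  classical
  ext i
  rw [coeff_diagHom, MvPowerSeries.coeff_mul, MvPowerSeries.coeff_mul]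
  split_ifs with hi
  · refine Finset.sum_congr rfl fun z hz => ?_
    rw [coeff_diagHom]
    by_cases h1 : MvPowerSeries.coeff z.1 c = 0
    · simp [h1]
    rw [if_pos]
    rw [← Finset.HasAntidiagonal.mem_antidiagonal.mp hz, toInt_add] at hi
    exact (G.add_mem_cancel_left (hc _ h1)).mp hi
  · symm
    refine Finset.sum_eq_zero fun z hz => ?_
    rw [coeff_diagHom]
    by_cases h1 : MvPowerSeries.coeff z.1 c = 0
    · simp [h1]
    rw [if_neg, mul_zero]
    rw [← Finset.HasAntidiagonal.mem_antidiagonal.mp hz, toInt_add] at hi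
    exact fun h2 => hi (G.add_mem (hc _ h1) h2)

theorem diagHom_pow (p : ℕ) [Fact p.Prime] [CharP k p] (hsat : ∀ v, p • v ∈ G → v ∈ G)
    (h : MvPowerSeries (Fin n) k) : diagHom G (h ^ p) = diagHom G h ^ p := by
  classical
  ext x
  rw [coeff_diagHom]
  by_cases hx : ∃ i, x = p • i
  · obtain ⟨i, rfl⟩ := hx
    have : toInt (p • i) ∈ G ↔ toInt i ∈ G := by
      rw [toInt_smul]
      exact ⟨hsat _, fun h => G.nsmul_mem h p⟩
    rw [coeff_pow_char_smul, coeff_pow_char_smul, coeff_diagHom]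
    simp only [this]
    split_ifs
    · rfl
    · simp [(Fact.out : p.Prime).ne_zero]
  · have h0 : ∀ g : MvPowerSeries (Fin n) k, MvPowerSeries.coeff x (g ^ p) = 0 := fun g => by
      by_contra hc
      exact hx (exists_eq_smul_of_coeff_pow_char_ne_zero p hc)
    simp [h0]

end Diagonal

/-! ### The Cartier operator and residues at a simple root. -/

section Cartier

open Polynomial

variable {R : Type*} [CommRing R] (p : ℕ) (S : R →+ R)

/-- The operator on `R[y]` sending `∑ q(j) y ^ j` to `∑ S(q(p j + p - 1)) y ^ j`. -/
def cartier (Q : R[X]) : R[X] :=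
  ∑ j ∈ Finset.range (Q.natDegree + 1), monomial j (S (Q.coeff (p * j + (p - 1))))

variable [Fact p.Prime]

theorem coeff_cartier (Q : R[X]) (j : ℕ) :
    (cartier p S Q).coeff j = S (Q.coeff (p * j + (p - 1))) := by
  have hp : 0 < p := (Fact.out : p.Prime).pos
  simp only [cartier, finsetSum_coeff, coeff_monomial, Finset.sum_ite_eq', Finset.mem_range]
  split_ifs with h
  · rfl
  · rw [coeff_eq_zero_of_natDegree_lt, map_zero]
    have := Nat.le_mul_of_pos_left j hp
    omega

theorem cartier_add (P Q : R[X]) : cartier p S (P + Q) = cartier p S P + cartier p S Q := by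
  ext j
  simp [coeff_cartier]

variable [CharP R p]

/-- By additivity `H` may be taken to be `c y ^ m`; its `p`-th power shifts degrees by `m p`, hence
the extracted ones by `m`. -/
theorem cartier_pow_mul (hS : ∀ a b, S (a ^ p * b) = a * S b) (H Q : R[X]) :
    cartier p S (H ^ p * Q) = H * cartier p S Q := by
  have hp : 0 < p := (Fact.out : p.Prime).pos
  induction H using Polynomial.induction_on' with
  | add H₁ H₂ h₁ h₂ => rw [add_pow_char, add_mul, cartier_add, h₁, h₂, add_mul]
  | monomial m c =>
    ext j
    rw [← C_mul_X_pow_eq_monomial, mul_pow, ← C_pow, ← pow_mul, mul_assoc, mul_assoc,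
      coeff_cartier, coeff_C_mul, hS, coeff_C_mul, coeff_X_pow_mul', coeff_X_pow_mul']
    have : m * p ≤ p * j + (p - 1) ↔ m ≤ j := by
      constructor
      · intro h
        by_contra hlt
        push Not at hlt
        have := Nat.mul_le_mul_left p hlt
        rw [mul_comm m p] at h
        rw [Nat.mul_succ] at this
        omega
      · intro h
        have := Nat.mul_le_mul_left p h
        rw [mul_comm m p]
        omega
    simp only [this]
    split_ifs with h
    · rw [coeff_cartier]
      congr 3
      have := Nat.mul_le_mul_left p h
      rw [Nat.mul_sub, mul_comm m p]
      omega
    · rw [map_zero]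

/-- Write `H = H(f) + (y - f) H₁`. The second term produces `(y - f) ^ p H₁`, whose image is
divisible by `y - f`. In the first, the index `p - 1` selects the leading coefficient of the monic
`(y - f) ^ (p - 1)`. -/
theorem eval_cartier_X_sub_C_pow_mul [Nontrivial R] (hS : ∀ a b, S (a ^ p * b) = a * S b)
    (f : R) (H : R[X]) :
    (cartier p S ((X - C f) ^ (p - 1) * H)).eval f = S (H.eval f) := by
  have hp : 0 < p := (Fact.out : p.Prime).pos
  obtain ⟨H₁, hH₁⟩ := X_sub_C_dvd_sub_C_eval (a := f) (p := H)
  have hH : H = C (H.eval f) + (X - C f) * H₁ := by rw [← hH₁]; ring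
  have hmonic : ((X - C f) ^ (p - 1)).Monic := (monic_X_sub_C f).pow _
  have hdeg : ((X - C f) ^ (p - 1)).natDegree = p - 1 := by
    rw [(monic_X_sub_C f).natDegree_pow, natDegree_X_sub_C, mul_one]
  have h₁ : cartier p S ((X - C f) ^ (p - 1) * C (H.eval f)) = C (S (H.eval f)) := by
    ext j
    rw [coeff_cartier, coeff_mul_C, coeff_C]
    split_ifs with hj
    · have : ((X - C f) ^ (p - 1)).coeff (p - 1) = 1 := by
        simpa [Monic, leadingCoeff, hdeg] using hmonic
      rw [hj, mul_zero, zero_add, this, one_mul]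
    · rw [coeff_eq_zero_of_natDegree_lt, zero_mul, map_zero]
      rw [hdeg]
      have := Nat.mul_pos hp (Nat.pos_of_ne_zero hj)
      omega
  have h₂ : (X - C f) ^ (p - 1) * ((X - C f) * H₁) = (X - C f) ^ p * H₁ := by
    rw [← mul_assoc, ← pow_succ, Nat.sub_add_cancel hp]
  conv_lhs => rw [hH]
  rw [mul_add, cartier_add, h₁, h₂, cartier_pow_mul p S hS]
  simp

/-- If `g = P(f) / A'(f)` with `A(f) = 0`, then `S(g)` is of the same form. -/
theorem eval_cartier_mul_pow [Nontrivial R] (hS : ∀ a b, S (a ^ p * b) = a * S b)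
    {A P : R[X]} {f g : R} (hA : A.eval f = 0) (hg : A.derivative.eval f * g = P.eval f) :
    (cartier p S (P * A ^ (p - 1))).eval f = A.derivative.eval f * S g := by
  have hp : 0 < p := (Fact.out : p.Prime).pos
  obtain ⟨B, rfl⟩ := dvd_iff_isRoot.mpr hA
  have hD : (derivative ((X - C f) * B)).eval f = B.eval f := by simp
  rw [hD] at hg ⊢
  -- With `A = (y - f) B` one has `A'(f) = B(f)` and `P(f) = B(f) g`, so the value sought is `S(B(f)
  -- ^ p g) = B(f) S(g)`.
  have : P * ((X - C f) * B) ^ (p - 1) = (X - C f) ^ (p - 1) * (P * B ^ (p - 1)) := by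
    rw [mul_pow]; ring
  rw [this, eval_cartier_X_sub_C_pow_mul p S hS, eval_mul, ← hg, eval_pow, ← hS]
  congr 1
  conv_rhs => rw [← Nat.sub_add_cancel hp, pow_succ]
  ring

end Cartier

/-! ### Separability of irreducible equations of power series. -/

section Separable

open Polynomial

variable {k : Type*} [Field k] {n : ℕ}

theorem inclusionK0_algebraMap (a : MvPolynomial (Fin n) k) :
    inclusionK0 k n (algebraMap _ (K0 k n) a) =
      algebraMap (MvPowerSeries (Fin n) k) (K k n) (algebraMap _ _ a) := by
  unfold inclusionK0 IsFractionRing.map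
  rw [IsLocalization.map_eq]

/-- By Gauss's lemma `A` stays irreducible over `k(t)`, where a polynomial not divisible by it is
coprime to it and cannot share the root `f`. -/
theorem natDegree_le_of_irreducible_of_root {A B : (MvPolynomial (Fin n) k)[X]}
    {f : MvPowerSeries (Fin n) k} (hirr : Irreducible A) (hA : aeval f A = 0) (hB : B ≠ 0)
    (hBf : aeval f B = 0) : 0 < A.natDegree ∧ A.natDegree ≤ B.natDegree := by
  have hinj := algebraMap_polynomial_injective k n
  have hpos : 0 < A.natDegree := by
    by_contra h
    rw [Nat.pos_iff_ne_zero, not_not] at h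
    rw [eq_C_of_natDegree_eq_zero h, aeval_C, map_eq_zero_iff _ hinj] at hA
    exact hirr.ne_zero (by rw [eq_C_of_natDegree_eq_zero h, hA, C_0])
  refine ⟨hpos, ?_⟩
  have hprim : A.IsPrimitive := hirr.isPrimitive hpos.ne'
  let L := FractionRing (MvPolynomial (Fin n) k)
  let φ : MvPolynomial (Fin n) k →+* L := algebraMap _ _
  have hφ : Function.Injective φ := IsFractionRing.injective _ _
  have hirr' : Irreducible (A.map φ) :=
    (hprim.irreducible_iff_irreducible_map_fraction_map (K := L)).mp hirr
  have key : ∀ Q : (MvPolynomial (Fin n) k)[X], (Q.map φ).eval₂ (inclusionK0 k n)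
      (algebraMap _ (K k n) f) = algebraMap _ (K k n) (aeval f Q) := by
    intro Q
    have hcomp : (inclusionK0 k n).comp φ = (algebraMap (MvPowerSeries (Fin n) k) (K k n)).comp
        (algebraMap (MvPolynomial (Fin n) k) (MvPowerSeries (Fin n) k)) := by
      refine RingHom.ext fun x => ?_
      exact inclusionK0_algebraMap x
    rw [eval₂_map, hcomp, aeval_def, hom_eval₂]
  have hdvd : A.map φ ∣ B.map φ := by
    by_contra hnd
    obtain ⟨u, v, huv⟩ := (hirr'.coprime_iff_not_dvd).mpr hnd
    have := congrArg (eval₂ (inclusionK0 k n) (algebraMap _ (K k n) f)) huv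
    rw [eval₂_add, eval₂_mul, eval₂_mul, key, key, hA, hBf] at this
    simp at this
  have hle := natDegree_le_of_dvd hdvd ((Polynomial.map_ne_zero_iff hφ).mpr hB)
  rwa [natDegree_map_eq_of_injective hφ, natDegree_map_eq_of_injective hφ] at hle

/-- Otherwise minimality of the degree gives `A' = 0`, so `A = A₀(y ^ p)`. Applying `S_u` to `∑ a_j
(f ^ j) ^ p = 0` yields `∑ S_u(a_j) f ^ j = 0`, an equation for `f` whose degree is smaller by a
factor `p`. -/
theorem aeval_derivative_ne_zero_of_irreducible (p : ℕ) [Fact p.Prime] [CharP k p]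
    [PerfectRing k p] {A : (MvPolynomial (Fin n) k)[X]}
    {f : MvPowerSeries (Fin n) k} (hirr : Irreducible A) (hA : aeval f A = 0) :
    aeval f (derivative A) ≠ 0 := by
  classical
  have hp : p.Prime := Fact.out
  have hmin : ∀ B, B ≠ 0 → aeval f B = 0 → A.natDegree ≤ B.natDegree := fun B h1 h2 =>
    (natDegree_le_of_irreducible_of_root hirr hA h1 h2).2
  have hpos := (natDegree_le_of_irreducible_of_root hirr hA hirr.ne_zero hA).1
  intro hder
  by_cases hd : derivative A = 0
  · have hexp : expand _ p (contract p A) = A := expand_contract p hd hp.ne_zero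
    set A₀ := contract p A with hA₀
    have hdeg : A.natDegree = A₀.natDegree * p := by rw [← hexp, natDegree_expand]
    have hA₀0 : A₀ ≠ 0 := by
      intro h
      rw [h, map_zero] at hexp
      exact hirr.ne_zero hexp.symm
    obtain ⟨i, hi⟩ := MvPolynomial.ne_zero_iff.mp (leadingCoeff_ne_zero.mpr hA₀0)
    -- The residue of an exponent of the leading coefficient, so that `S_u` does not kill that
    -- coefficient.
    let u : Fin n →₀ ℕ := i.mapRange (· % p) (Nat.zero_mod p)
    let i' : Fin n →₀ ℕ := i.mapRange (· / p) (Nat.zero_div p)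
    have hu : ∀ j, u j < p := fun j => Nat.mod_lt _ hp.pos
    have hx : i = p • i' + u := by
      ext j
      simp [u, i', Nat.div_add_mod]
    choose b hb using fun j => exists_mvPolynomial_sectionOp p u (A₀.coeff j)
    let B : (MvPolynomial (Fin n) k)[X] :=
      ∑ j ∈ Finset.range (A₀.natDegree + 1), monomial j (b j)
    have hBdeg : B.natDegree ≤ A₀.natDegree :=
      natDegree_sum_le_of_forall_le _ _ fun j hj =>
        (natDegree_monomial_le _).trans (Nat.lt_succ_iff.mp (Finset.mem_range.mp hj))
    have hB0 : B ≠ 0 := by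
      intro h
      have h1 : B.coeff A₀.natDegree = b A₀.natDegree := by
        simp [B, finsetSum_coeff, coeff_monomial]
      rw [h, coeff_zero] at h1
      have h2 := hb A₀.natDegree
      rw [← h1, map_zero] at h2
      have h3 := coeff_sectionOp_pow p u
        (algebraMap _ (MvPowerSeries (Fin n) k) (A₀.coeff A₀.natDegree)) i'
      rw [← h2, ← hx, coeff_algebraMap_mvPolynomial, map_zero, zero_pow hp.ne_zero] at h3
      exact hi h3.symm
    have hBf : aeval f B = 0 := by
      have h1 : aeval f A = ∑ j ∈ Finset.range (A₀.natDegree + 1),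
          algebraMap _ (MvPowerSeries (Fin n) k) (A₀.coeff j) * (f ^ j) ^ p := by
        rw [← hexp, expand_aeval, aeval_eq_sum_range]
        refine Finset.sum_congr rfl fun j _ => ?_
        rw [Algebra.smul_def, ← pow_mul, ← pow_mul, mul_comm p j]
      have h2 := congrArg (sectionOp p u) (hA.symm.trans h1)
      rw [map_zero, map_sum] at h2
      rw [h2, map_sum]
      refine Finset.sum_congr rfl fun j _ => ?_
      rw [aeval_monomial, hb, mul_comm _ ((f ^ j) ^ p), sectionOp_pow_mul p u hu, mul_comm]
    have h4 := (hmin B hB0 hBf).trans hBdeg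
    rw [hdeg] at h4 hpos
    have h5 : 0 < A₀.natDegree := Nat.pos_of_mul_pos_right hpos
    have h6 := Nat.mul_le_mul_left A₀.natDegree hp.two_le
    omega
  · exact absurd (hmin _ hd hder) (not_le.mpr (natDegree_derivative_lt hpos.ne'))

end Separable

/-! ### Fractions of polynomials supported on `G`. -/

section FractionSubfield

variable {k : Type*} [Field k] {n : ℕ} (G : AddSubgroup (Fin n → ℤ))

/-- The ring of polynomials supported on `G`. -/
def polyRG : Subring (MvPolynomial (Fin n) k) :=
  (RG k G).toSubring.comap (algebraMap (MvPolynomial (Fin n) k) (MvPowerSeries (Fin n) k))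

theorem mem_polyRG {a : MvPolynomial (Fin n) k} :
    a ∈ polyRG G ↔ ∀ i, a.coeff i ≠ 0 → toInt i ∈ G := by
  change (∀ i, MvPowerSeries.coeff i _ ≠ 0 → _) ↔ _
  simp only [coeff_algebraMap_mvPolynomial]

theorem monomial_mem_polyRG {i : Fin n →₀ ℕ} (hi : toInt i ∈ G) (c : k) :
    MvPolynomial.monomial i c ∈ polyRG G := by
  classical
  rw [mem_polyRG]
  intro j hj
  rw [MvPolynomial.coeff_monomial] at hj
  split_ifs at hj with h
  · rwa [← h]
  · exact absurd rfl hj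

variable (k n) in
/-- The inclusion of polynomials in the fraction field of the ring of power series. -/
def polyToK : MvPolynomial (Fin n) k →+* K k n :=
  (algebraMap (MvPowerSeries (Fin n) k) (K k n)).comp
    (algebraMap (MvPolynomial (Fin n) k) (MvPowerSeries (Fin n) k))

theorem polyToK_injective : Function.Injective (polyToK k n) :=
  (IsFractionRing.injective (MvPowerSeries (Fin n) k) (K k n)).comp
    (algebraMap_polynomial_injective k n)

theorem polyToK_ne_zero {a : MvPolynomial (Fin n) k} (ha : a ≠ 0) : polyToK k n a ≠ 0 :=
  (map_ne_zero_iff _ polyToK_injective).mpr ha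

/-- The subfield of `K` of the fractions of polynomials supported on `G`. -/
def fracRG : Subfield (K k n) where
  carrier := {x | ∃ a ∈ polyRG (k := k) G, ∃ b ∈ polyRG (k := k) G, b ≠ 0 ∧
    polyToK k n b * x = polyToK k n a}
  mul_mem' := by
    rintro x y ⟨a, ha, b, hb, hb0, h⟩ ⟨a', ha', b', hb', hb0', h'⟩
    refine ⟨a * a', mul_mem ha ha', b * b', mul_mem hb hb', mul_ne_zero hb0 hb0', ?_⟩
    rw [map_mul, map_mul, ← h, ← h']
    ring
  one_mem' := ⟨1, one_mem _, 1, one_mem _, one_ne_zero, by simp⟩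
  add_mem' := by
    rintro x y ⟨a, ha, b, hb, hb0, h⟩ ⟨a', ha', b', hb', hb0', h'⟩
    refine ⟨a * b' + a' * b, add_mem (mul_mem ha hb') (mul_mem ha' hb), b * b', mul_mem hb hb',
      mul_ne_zero hb0 hb0', ?_⟩
    rw [map_mul, map_add, map_mul, map_mul, ← h, ← h']
    ring
  zero_mem' := ⟨0, zero_mem _, 1, one_mem _, one_ne_zero, by simp⟩
  neg_mem' := by
    rintro x ⟨a, ha, b, hb, hb0, h⟩
    exact ⟨-a, neg_mem ha, b, hb, hb0, by rw [map_neg, ← h, mul_neg]⟩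
  inv_mem' := by
    rintro x ⟨a, ha, b, hb, hb0, h⟩
    by_cases hx : x = 0
    · exact ⟨0, zero_mem _, 1, one_mem _, one_ne_zero, by simp [hx]⟩
    · refine ⟨b, hb, a, ha, ?_, ?_⟩
      · rintro rfl
        rw [map_zero] at h
        exact mul_ne_zero (polyToK_ne_zero hb0) hx h
      · rw [← h, mul_assoc, mul_inv_cancel₀ hx, mul_one]

theorem mem_fracRG {x : K k n} : x ∈ fracRG G ↔ ∃ a ∈ polyRG (k := k) G,
    ∃ b ∈ polyRG (k := k) G, b ≠ 0 ∧ polyToK k n b * x = polyToK k n a := Iff.rfl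

theorem exists_common_denominator {ι : Type*} [DecidableEq ι] (s : Finset ι)
    (c : ι → fracRG (k := k) G) :
    ∃ b ∈ polyRG (k := k) G, b ≠ 0 ∧ ∀ i ∈ s, ∃ a ∈ polyRG (k := k) G,
      polyToK k n b * (c i : K k n) = polyToK k n a := by
  induction s using Finset.induction_on with
  | empty => exact ⟨1, one_mem _, one_ne_zero, by simp⟩
  | insert i s _ ih =>
    obtain ⟨b, hb, hb0, h⟩ := ih
    obtain ⟨a', ha', b', hb', hb0', h'⟩ := (mem_fracRG G).mp (c i).2
    refine ⟨b * b', mul_mem hb hb', mul_ne_zero hb0 hb0', fun j hj => ?_⟩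
    rcases Finset.mem_insert.mp hj with rfl | hj
    · exact ⟨b * a', mul_mem hb ha', by rw [map_mul, map_mul, ← h', mul_assoc]⟩
    · obtain ⟨a, ha, haj⟩ := h j hj
      exact ⟨b' * a, mul_mem hb' ha, by rw [map_mul, map_mul, ← haj]; ring⟩

variable {G}

/-- If some `g₀ ∈ G ∩ ℕⁿ` is positive wherever an element of `G` can be nonzero, then every
element of `G` is a difference of elements of `G ∩ ℕⁿ`. -/
theorem exists_eq_toInt_sub_toInt {g₀ : Fin n →₀ ℕ} (hg₀ : toInt g₀ ∈ G)
    (hpos : ∀ v ∈ G, ∀ j, v j ≠ 0 → 0 < g₀ j) {z : Fin n → ℤ} (hz : z ∈ G) :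
    ∃ a b : Fin n →₀ ℕ, toInt a ∈ G ∧ toInt b ∈ G ∧ z = toInt a - toInt b := by
  -- Adding `m • g₀` makes `z` nonnegative: `m ≥ |z j|`, and `g₀ j ≥ 1` wherever `z j ≠ 0`.
  let m : ℕ := ∑ j, (z j).natAbs
  have hm : ∀ j, (z j).natAbs ≤ m := fun j =>
    Finset.single_le_sum (f := fun j => (z j).natAbs) (fun _ _ => Nat.zero_le _)
      (Finset.mem_univ j)
  let a : Fin n →₀ ℕ := Finsupp.equivFunOnFinite.symm fun j => (z j + m * g₀ j).toNat
  have ha : toInt a = z + toInt (m • g₀) := by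
    funext j
    have : 0 ≤ z j + m * g₀ j := by
      by_cases h : z j = 0
      · rw [h]; positivity
      · have h1 := hm j
        have h2 : m * 1 ≤ m * g₀ j := Nat.mul_le_mul_left m (hpos z hz j h)
        rw [mul_one] at h2
        have h3 : ((m * g₀ j : ℕ) : ℤ) = m * g₀ j := by push_cast; rfl
        omega
    simp [toInt, a, Int.toNat_of_nonneg this]
  have hb : toInt (m • g₀) ∈ G := by
    rw [toInt_smul]
    exact G.nsmul_mem hg₀ m
  exact ⟨a, m • g₀, ha ▸ G.add_mem hz hb, hb, by rw [ha, add_sub_cancel_right]⟩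

theorem toInt_injective : Function.Injective (toInt : (Fin n →₀ ℕ) → Fin n → ℤ) := by
  intro a b h
  ext j
  simpa [toInt] using congrFun h j

/-- The coefficient is `t ^ a / t ^ b`, where `x - y = a - b` with `a, b ∈ G ∩ ℕⁿ`. This is why
dimensions are bounded by numbers of classes modulo `G`. -/
theorem exists_smul_monomial {g₀ : Fin n →₀ ℕ} (hg₀ : toInt g₀ ∈ G)
    (hpos : ∀ v ∈ G, ∀ j, v j ≠ 0 → 0 < g₀ j) {x y : Fin n →₀ ℕ}
    (hxy : toInt x - toInt y ∈ G) :
    ∃ c : fracRG (k := k) G, polyToK k n (MvPolynomial.monomial x 1) =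
      (c : K k n) * polyToK k n (MvPolynomial.monomial y 1) := by
  obtain ⟨a, b, ha, hb, hab⟩ := exists_eq_toInt_sub_toInt hg₀ hpos hxy
  have hb0 : (MvPolynomial.monomial b (1 : k)) ≠ 0 := by simp
  have hadd : b + x = a + y := by
    apply toInt_injective
    rw [toInt_add, toInt_add, add_comm, ← sub_eq_sub_iff_add_eq_add, hab]
  have hmul : polyToK k n (MvPolynomial.monomial b 1) * polyToK k n (MvPolynomial.monomial x 1) =
      polyToK k n (MvPolynomial.monomial a 1) * polyToK k n (MvPolynomial.monomial y 1) := by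
    rw [← map_mul, ← map_mul, MvPolynomial.monomial_mul, MvPolynomial.monomial_mul, hadd]
  have hbK := polyToK_ne_zero hb0
  refine ⟨⟨polyToK k n (MvPolynomial.monomial a 1) / polyToK k n (MvPolynomial.monomial b 1),
    (mem_fracRG G).mpr ⟨_, monomial_mem_polyRG G ha 1, _, monomial_mem_polyRG G hb 1, hb0, ?_⟩⟩, ?_⟩
  · field_simp
  · rw [div_mul_eq_mul_div, ← hmul]
    field_simp

end FractionSubfield

/-! ### Frobenius-semilinear algebra. -/

section LinearAlgebra

variable {L : Type*} [Field L] {F : Subfield L}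

/-- Among vectors whose multiples by a nonzero `d` lie in the span of `N` vectors, at most `N`
suffice to span all of them. -/
theorem exists_finset_span_of_mul_mem_span {s : Set L} {d : L} (hd : d ≠ 0) (w : Finset L)
    (h : ∀ x ∈ s, d * x ∈ Submodule.span F (w : Set L)) :
    ∃ t : Finset L, (t : Set L) ⊆ s ∧ t.card ≤ w.card ∧
      ∀ x ∈ s, x ∈ Submodule.span F (t : Set L) := by
  obtain ⟨b, hbs, hspan, hli⟩ := exists_linearIndependent F s
  -- Multiplication by `d` sends a maximal independent subset of `s` to an independent family in the
  -- span of `w`.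
  have hinj : LinearMap.ker (LinearMap.mulLeft F d) = ⊥ :=
    LinearMap.ker_eq_bot.mpr (mul_right_injective₀ hd)
  have hli' := hli.map' (LinearMap.mulLeft F d) hinj
  have hrange : Set.range (⇑(LinearMap.mulLeft F d) ∘ ((↑) : b → L)) ⊆
      Submodule.span F (w : Set L) := by
    rintro _ ⟨x, rfl⟩
    exact h _ (hbs x.2)
  have : Finite b := LinearIndependent.finite_of_le_span_finite _ hli' _ hrange
  have : Fintype b := Fintype.ofFinite b
  have hcard := linearIndependent_le_span_aux' _ hli' _ hrange
  refine ⟨b.toFinset, by simpa using hbs, ?_, fun x hx => ?_⟩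
  · rw [Set.toFinset_card]
    simpa using hcard
  · rw [Set.coe_toFinset, hspan]
    exact Submodule.subset_span hx

theorem pow_mem_span_image_pow (p : ℕ) [Fact p.Prime] [CharP L p] (m : ℕ) {s : Set L} {x : L}
    (hx : x ∈ Submodule.span F s) :
    x ^ p ^ m ∈ Submodule.span F ((fun y => y ^ p ^ m) '' s) := by
  have hp : p ^ m ≠ 0 := pow_ne_zero _ (Fact.out : p.Prime).ne_zero
  induction hx using Submodule.span_induction with
  | mem x hx => exact Submodule.subset_span ⟨x, hx, rfl⟩
  | zero => rw [zero_pow hp]; exact zero_mem _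
  | add x y _ _ hx hy => rw [add_pow_char_pow]; exact add_mem hx hy
  | smul c x _ hx => rw [smul_pow]; exact Submodule.smul_mem _ _ hx

/-- If the elements of `s` lie in the span of the `p`-th powers of elements of `s`, and `s` is
spanned by at most `N` of its elements, then the iterated `p`-th powers of any element of `s` up to
the exponent `p ^ N` are linearly dependent. -/
theorem exists_linear_relation_pow (p : ℕ) [Fact p.Prime] [CharP L p] {s : Set L}
    (hs : ∀ x ∈ s, x ∈ Submodule.span F ((fun y => y ^ p) '' s)) {N : ℕ} {t : Finset L}
    (ht : t.card ≤ N) (hst : ∀ x ∈ s, x ∈ Submodule.span F (t : Set L)) {x : L} (hx : x ∈ s) :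
    ∃ c : Fin (N + 1) → F, ∑ i, c i • x ^ p ^ (i : ℕ) = 0 ∧ ∃ i, c i ≠ 0 := by
  classical
  have hiter : ∀ m : ℕ, ∀ y ∈ s, y ∈ Submodule.span F ((fun z => z ^ p ^ m) '' s) := by
    intro m
    induction m with
    | zero => intro y hy; exact Submodule.subset_span ⟨y, hy, by simp⟩
    | succ m ih =>
      intro y hy
      refine Submodule.span_le.mpr ?_ (ih y hy)
      rintro _ ⟨z, hz, rfl⟩
      have := pow_mem_span_image_pow p m (hs z hz)
      rw [Set.image_image] at this
      rw [SetLike.mem_coe]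
      simpa only [← pow_mul, ← pow_succ'] using this
  rw [← Fintype.not_linearIndependent_iff]
  intro hli
  have hrange : Set.range (fun i : Fin (N + 1) => x ^ p ^ (i : ℕ)) ⊆
      Submodule.span F ((t.image fun z => z ^ p ^ N : Finset L) : Set L) := by
    rintro _ ⟨i, rfl⟩
    -- Expressing `x` through `p ^ (N - i)`-th powers before raising to the power `p ^ i` brings all
    -- the `x ^ p ^ i` into the span of the same `p ^ N`-th powers.
    have h1 := pow_mem_span_image_pow p i (hiter (N - i) x hx)
    rw [Set.image_image] at h1
    refine Submodule.span_le.mpr ?_ h1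
    rintro _ ⟨z, hz, rfl⟩
    have h2 := pow_mem_span_image_pow p N (hst z hz)
    rw [Finset.coe_image]
    simp only [← pow_mul, ← pow_add]
    rwa [Nat.sub_add_cancel (Nat.lt_succ_iff.mp i.2)]
  have h3 := linearIndependent_le_span_aux' _ hli _ hrange
  simp only [Fintype.card_fin, Finset.coe_sort_coe, Fintype.card_coe] at h3
  have h4 : (t.image fun z => z ^ p ^ N).card ≤ t.card := Finset.card_image_le
  omega

end LinearAlgebra

/-! ### Residues with prescribed exponents and their sections. -/

section Stable

open Polynomial

variable {k : Type*} [Field k] {n : ℕ}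

theorem exists_of_coeff_coeff_mul_ne_zero {P Q : (MvPolynomial (Fin n) k)[X]} {i : Fin n →₀ ℕ}
    {j : ℕ} (h : ((P * Q).coeff j).coeff i ≠ 0) :
    ∃ i₁ j₁ i₂ j₂, (P.coeff j₁).coeff i₁ ≠ 0 ∧ (Q.coeff j₂).coeff i₂ ≠ 0 ∧ i₁ + i₂ = i ∧
      j₁ + j₂ = j := by
  classical
  rw [coeff_mul, MvPolynomial.coeff_sum] at h
  obtain ⟨z, hz, hne⟩ := Finset.exists_ne_zero_of_sum_ne_zero h
  rw [MvPolynomial.coeff_mul] at hne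
  obtain ⟨w, hw, hne⟩ := Finset.exists_ne_zero_of_sum_ne_zero hne
  exact ⟨w.1, z.1, w.2, z.2, left_ne_zero_of_mul hne, right_ne_zero_of_mul hne,
    Finset.HasAntidiagonal.mem_antidiagonal.mp hw, Finset.HasAntidiagonal.mem_antidiagonal.mp hz⟩

theorem algebraMap_monomial (v : Fin n →₀ ℕ) (c : k) :
    algebraMap _ (MvPowerSeries (Fin n) k) (MvPolynomial.monomial v c) =
      MvPowerSeries.monomial v c := by
  classical
  ext i
  rw [coeff_algebraMap_mvPolynomial, MvPolynomial.coeff_monomial, MvPowerSeries.coeff_monomial]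
  simp only [eq_comm]

/-- The power series `g` with `A'(f) g = P(f)` for some polynomial `P` supported on `X`. -/
def residues (A : (MvPolynomial (Fin n) k)[X]) (f : MvPowerSeries (Fin n) k)
    (X : Set ((Fin n →₀ ℕ) × ℕ)) : Set (MvPowerSeries (Fin n) k) :=
  {g | ∃ P : (MvPolynomial (Fin n) k)[X], (∀ i j, (P.coeff j).coeff i ≠ 0 → (i, j) ∈ X) ∧
    aeval f (derivative A) * g = aeval f P}

/-- The numerator is `y A'`, whose exponents are among those of `A`. -/
theorem mem_residues_self {A : (MvPolynomial (Fin n) k)[X]} {f : MvPowerSeries (Fin n) k}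
    {X : Set ((Fin n →₀ ℕ) × ℕ)} (hX : ∀ i j, (A.coeff j).coeff i ≠ 0 → (i, j) ∈ X) :
    f ∈ residues A f X := by
  refine ⟨derivative A * Polynomial.X, fun i j h => hX i j fun h0 => h ?_, by simp⟩
  cases j with
  | zero => simp
  | succ j =>
    rw [coeff_mul_X, coeff_derivative, ← Nat.cast_succ, mul_comm, ← nsmul_eq_mul,
      MvPolynomial.coeff_smul, h0, smul_zero]

/-- The monomials `t ^ i f ^ j`, with `i` in a set of representatives modulo `G`, span the
multiples by `A'(f)` of the power series in `residues A f X`. -/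
theorem mul_mem_span_of_mem_residues {G : AddSubgroup (Fin n → ℤ)} {g₀ : Fin n →₀ ℕ}
    (hg₀ : toInt g₀ ∈ G) (hpos : ∀ v ∈ G, ∀ j, v j ≠ 0 → 0 < g₀ j)
    {A : (MvPolynomial (Fin n) k)[X]} {f : MvPowerSeries (Fin n) k} {X : Set ((Fin n →₀ ℕ) × ℕ)}
    {Y : Finset ((Fin n →₀ ℕ) × ℕ)}
    (hY : ∀ x ∈ X, ∃ y ∈ Y, y.2 = x.2 ∧ toInt x.1 - toInt y.1 ∈ G)
    {g : MvPowerSeries (Fin n) k} (hg : g ∈ residues A f X) :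
    algebraMap _ (K k n) (aeval f (derivative A)) * algebraMap _ (K k n) g ∈
      Submodule.span (fracRG (k := k) G) ((fun y : (Fin n →₀ ℕ) × ℕ =>
        polyToK k n (MvPolynomial.monomial y.1 1) * algebraMap _ (K k n) f ^ y.2) '' Y) := by
  obtain ⟨P, hP, hPg⟩ := hg
  have hconst : ∀ c : k, polyToK k n (MvPolynomial.C c) ∈ fracRG (k := k) G := fun c =>
    (mem_fracRG G).mpr ⟨_, monomial_mem_polyRG G (by rw [toInt_zero]; exact G.zero_mem) c, 1,
      one_mem _, one_ne_zero, by rw [map_one, one_mul]; rfl⟩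
  rw [← map_mul, hPg, aeval_eq_sum_range, map_sum]
  refine Submodule.sum_mem _ fun j _ => ?_
  rw [Algebra.smul_def, map_mul, map_pow]
  change polyToK k n (P.coeff j) * _ ∈ _
  rw [MvPolynomial.as_sum (P.coeff j), map_sum, Finset.sum_mul]
  refine Submodule.sum_mem _ fun i hi => ?_
  obtain ⟨y, hyY, hy2, hy⟩ := hY _ (hP i j (MvPolynomial.mem_support_iff.mp hi))
  obtain ⟨c, hc⟩ := exists_smul_monomial (k := k) hg₀ hpos hy
  have hmon : MvPolynomial.monomial i (MvPolynomial.coeff i (P.coeff j)) =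
      MvPolynomial.C (MvPolynomial.coeff i (P.coeff j)) * MvPolynomial.monomial i 1 := by
    rw [MvPolynomial.C_mul_monomial, mul_one]
  have : polyToK k n (MvPolynomial.monomial i (MvPolynomial.coeff i (P.coeff j))) *
      algebraMap _ (K k n) f ^ j =
      ((⟨_, hconst (MvPolynomial.coeff i (P.coeff j))⟩ : fracRG (k := k) G) * c) •
      (polyToK k n (MvPolynomial.monomial y.1 1) * algebraMap _ (K k n) f ^ y.2) := by
    rw [hmon, map_mul, hc, hy2, Subfield.smul_def, smul_eq_mul, Subfield.coe_mul]
    ring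
  rw [this]
  exact Submodule.smul_mem _ _ (Submodule.subset_span ⟨y, hyY, rfl⟩)

/-- The diagonal of a combination with coefficients in the fractions of polynomials supported
on `G`. -/
theorem diagHom_mem_span {G : AddSubgroup (Fin n → ℤ)} {t : Finset (MvPowerSeries (Fin n) k)}
    {g : MvPowerSeries (Fin n) k}
    (hg : algebraMap _ (K k n) g ∈ Submodule.span (fracRG (k := k) G)
      (algebraMap (MvPowerSeries (Fin n) k) (K k n) '' t)) :
    algebraMap _ (K k n) (diagHom G g) ∈ Submodule.span (fracRG (k := k) G)
      ((fun h => algebraMap (MvPowerSeries (Fin n) k) (K k n) (diagHom G h)) '' t) := by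
  classical
  rw [Submodule.mem_span_image_finset_iff_exists_fun] at hg ⊢
  obtain ⟨c, hc⟩ := hg
  refine ⟨c, ?_⟩
  obtain ⟨b, hb, hb0, ha⟩ := exists_common_denominator G Finset.univ c
  choose! a ha hac using ha
  let ι : MvPolynomial (Fin n) k →+* MvPowerSeries (Fin n) k := algebraMap _ _
  -- Clearing denominators gives an identity of power series with coefficients supported on `G`, to
  -- which the diagonal can be applied termwise.
  have h1 : ι b * g = ∑ i, ι (a i) * (i : MvPowerSeries (Fin n) k) := by
    apply IsFractionRing.injective (MvPowerSeries (Fin n) k) (K k n)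
    rw [map_mul, ← hc, map_sum, Finset.mul_sum]
    refine Finset.sum_congr rfl fun i _ => ?_
    rw [map_mul, Subfield.smul_def, smul_eq_mul, ← mul_assoc]
    exact congrArg (· * _) (hac i (Finset.mem_univ i))
  have h2 := congrArg (diagHom G) h1
  rw [diagHom_mul G hb, map_sum] at h2
  apply mul_left_cancel₀ (polyToK_ne_zero hb0)
  have h3 := congrArg (algebraMap _ (K k n)) h2
  rw [map_mul] at h3
  refine Eq.trans ?_ h3.symm
  rw [map_sum, Finset.mul_sum]
  refine Finset.sum_congr rfl fun i _ => ?_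
  rw [diagHom_mul G (ha i (Finset.mem_univ i)), map_mul, Subfield.smul_def, smul_eq_mul,
    ← mul_assoc, hac i (Finset.mem_univ i)]
  rfl

variable (p : ℕ) [Fact p.Prime] [CharP k p] [PerfectRing k p]

theorem exists_map_eq_cartier (u : Fin n →₀ ℕ) (Q : (MvPolynomial (Fin n) k)[X]) :
    ∃ Q' : (MvPolynomial (Fin n) k)[X],
      Q'.map (algebraMap _ (MvPowerSeries (Fin n) k)) =
        cartier p (sectionOp p u) (Q.map (algebraMap _ (MvPowerSeries (Fin n) k))) := by
  choose b hb using fun j => exists_mvPolynomial_sectionOp p u (Q.coeff j)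
  refine ⟨∑ j ∈ Finset.range ((Q.map (algebraMap _ (MvPowerSeries (Fin n) k))).natDegree + 1),
    monomial j (b (p * j + (p - 1))), ?_⟩
  rw [cartier, Polynomial.map_sum]
  refine Finset.sum_congr rfl fun j _ => ?_
  rw [map_monomial, hb, coeff_map]

/-- The set `X` of exponents is stable under the section operators attached to `A` and `G`. -/
def IsStable (G : AddSubgroup (Fin n → ℤ)) (A : (MvPolynomial (Fin n) k)[X])
    (X : Set ((Fin n →₀ ℕ) × ℕ)) : Prop :=
  ∀ i j a b i' j', (i, j) ∈ X → ((A ^ (p - 1)).coeff b).coeff a ≠ 0 →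
    toInt (i + a) - p • toInt i' ∈ G → j + b = p * j' + (p - 1) → (i', j') ∈ X

/-- The new numerator is `t ^ v` times the Cartier image of `P A ^ (p - 1)`. For an exponent `x` of
it in `t`, `p (x - v) + u = i + a` with `i` from `P` and `a` from `A ^ (p - 1)`; as `u ≡ p v` modulo
`G`, this gives `p x ≡ i + a`, the congruence in `IsStable`. -/
theorem monomial_mul_sectionOp_mem_residues {G : AddSubgroup (Fin n → ℤ)}
    {A : (MvPolynomial (Fin n) k)[X]} {f : MvPowerSeries (Fin n) k} (hA : aeval f A = 0)
    {X : Set ((Fin n →₀ ℕ) × ℕ)} (hX : IsStable p G A X) {u v : Fin n →₀ ℕ} (hu : ∀ j, u j < p)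
    (huv : toInt u - p • toInt v ∈ G) {g : MvPowerSeries (Fin n) k} (hg : g ∈ residues A f X) :
    MvPowerSeries.monomial v 1 * sectionOp p u g ∈ residues A f X := by
  have : CharP (MvPowerSeries (Fin n) k) p :=
    charP_of_injective_algebraMap (algebraMap k (MvPowerSeries (Fin n) k)).injective p
  obtain ⟨P, hP, hPg⟩ := hg
  let ι : MvPolynomial (Fin n) k →+* MvPowerSeries (Fin n) k := algebraMap _ _
  have hev : ∀ Q : (MvPolynomial (Fin n) k)[X], aeval f Q = (Q.map ι).eval f := fun Q =>
    (eval_map_algebraMap Q f).symm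
  obtain ⟨Q, hQ⟩ := exists_map_eq_cartier p u (P * A ^ (p - 1))
  refine ⟨C (MvPolynomial.monomial v 1) * Q, fun x j' hx => ?_, ?_⟩
  · rw [coeff_C_mul, MvPolynomial.coeff_monomial_mul'] at hx
    split_ifs at hx with hvx
    · rw [one_mul] at hx
      have h1 : MvPowerSeries.coeff (x - v) ((Q.map ι).coeff j') ≠ 0 := by
        rwa [coeff_map, coeff_algebraMap_mvPolynomial]
      rw [hQ, coeff_cartier, coeff_sectionOp, coeff_map, coeff_algebraMap_mvPolynomial] at h1
      have h2 : ((P * A ^ (p - 1)).coeff (p * j' + (p - 1))).coeff (p • (x - v) + u) ≠ 0 := by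
        intro h
        rw [h, map_zero] at h1
        exact h1 rfl
      obtain ⟨i, j, a, b, h3, h4, h5, h6⟩ := exists_of_coeff_coeff_mul_ne_zero h2
      refine hX i j a b x j' (hP i j h3) h4 ?_ h6
      have h7 : x = (x - v) + v := (tsub_add_cancel_of_le hvx).symm
      have h8 : toInt x = toInt (x - v) + toInt v := by rw [← toInt_add, ← h7]
      rw [h5, toInt_add, toInt_smul, h8, smul_add]
      convert huv using 1
      abel
    · exact absurd rfl hx
  · have hA' : (A.map ι).eval f = 0 := by rw [← hev, hA]
    have hg' : (derivative (A.map ι)).eval f * g = (P.map ι).eval f := by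
      rw [derivative_map, ← hev, ← hev, hPg]
    have key := eval_cartier_mul_pow p (sectionOp p u) (sectionOp_pow_mul p u hu) hA' hg'
    rw [← Polynomial.map_pow, ← Polynomial.map_mul, ← hQ, derivative_map, ← hev, ← hev] at key
    rw [map_mul, key, aeval_C]
    rw [algebraMap_monomial]
    ring

end Stable

/-! ### The linear relation for a simple root over a perfect field. -/

section Core

open Polynomial

variable {k : Type*} [Field k] {n : ℕ}

section

variable (p : ℕ) [Fact p.Prime] [CharP k p]

theorem diagHom_monomial_mul_pow_eq_zero {G : AddSubgroup (Fin n → ℤ)} {u : Fin n →₀ ℕ}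
    (hu : ∀ i : Fin n →₀ ℕ, toInt (u + p • i) ∉ G) (g : MvPowerSeries (Fin n) k) :
    diagHom G (MvPowerSeries.monomial u 1 * g ^ p) = 0 := by
  classical
  ext x
  rw [coeff_diagHom, map_zero, MvPowerSeries.coeff_monomial_mul]
  split_ifs with hx hux
  · rw [one_mul]
    by_contra hne
    obtain ⟨i, hi⟩ := exists_eq_smul_of_coeff_pow_char_ne_zero p hne
    refine hu i ?_
    rwa [← hi, add_tsub_cancel_of_le hux]
  · rfl
  · rfl

/-- The choice `v = -i` would do but for signs, which a multiple of `g₀` repairs: if `i j ≠ 0` then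
`u + p • i`, an element of `G`, is nonzero at `j`, so `g₀ j > 0`. -/
theorem exists_sub_smul_mem {G : AddSubgroup (Fin n → ℤ)} {g₀ : Fin n →₀ ℕ}
    (hg₀ : toInt g₀ ∈ G) (hpos : ∀ v ∈ G, ∀ j, v j ≠ 0 → 0 < g₀ j) {u i : Fin n →₀ ℕ}
    (h : toInt (u + p • i) ∈ G) : ∃ v : Fin n →₀ ℕ, toInt u - p • toInt v ∈ G := by
  have hp : 0 < p := (Fact.out : p.Prime).pos
  let m : ℕ := ∑ j, i j
  have hle : i ≤ m • g₀ := by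
    intro j
    have h1 : i j ≤ m := Finset.single_le_sum (f := fun j => i j) (fun _ _ => Nat.zero_le _)
      (Finset.mem_univ j)
    rcases Nat.eq_zero_or_pos (i j) with h0 | h0
    · rw [h0]; exact Nat.zero_le _
    · have h2 : toInt (u + p • i) j ≠ 0 := by
        have := Nat.mul_pos hp h0
        simp only [toInt, Finsupp.coe_add, Finsupp.coe_smul, Pi.add_apply, Pi.smul_apply,
          smul_eq_mul]
        omega
      calc i j ≤ m * 1 := by rwa [mul_one]
        _ ≤ m * g₀ j := Nat.mul_le_mul_left m (hpos _ h j h2)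
        _ = (m • g₀) j := rfl
  refine ⟨m • g₀ - i, ?_⟩
  have h3 : toInt (m • g₀ - i) = m • toInt g₀ - toInt i := by
    rw [eq_sub_iff_add_eq, ← toInt_add, tsub_add_cancel_of_le hle, toInt_smul]
  rw [h3, smul_sub]
  rw [toInt_add, toInt_smul] at h
  convert G.sub_mem h (G.nsmul_mem (G.nsmul_mem hg₀ m) p) using 1
  abel

/-- Formally `t ^ u g ^ p = t ^ (u - p v) (t ^ v g) ^ p`, and the first factor comes out of the
diagonal. Writing `u - p v = a - b` with `a, b ∈ G ∩ ℕⁿ` avoids negative exponents. -/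
theorem diagHom_monomial_mul_pow {G : AddSubgroup (Fin n → ℤ)}
    (hsat : ∀ v, p • v ∈ G → v ∈ G) {g₀ : Fin n →₀ ℕ}
    (hg₀ : toInt g₀ ∈ G) (hpos : ∀ v ∈ G, ∀ j, v j ≠ 0 → 0 < g₀ j) {u v : Fin n →₀ ℕ}
    (huv : toInt u - p • toInt v ∈ G) (g : MvPowerSeries (Fin n) k) :
    ∃ c : fracRG (k := k) G, algebraMap _ (K k n)
        (diagHom G (MvPowerSeries.monomial u 1 * g ^ p)) =
      c • algebraMap _ (K k n) (diagHom G (MvPowerSeries.monomial v 1 * g)) ^ p := by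
  obtain ⟨a, b, ha, hb, hab⟩ := exists_eq_toInt_sub_toInt hg₀ hpos huv
  have hb0 : (MvPolynomial.monomial b (1 : k)) ≠ 0 := by simp
  have hadd : b + u = a + p • v := by
    apply toInt_injective
    rw [toInt_add, toInt_add, toInt_smul, add_comm, ← sub_eq_sub_iff_add_eq_add, hab]
  have hmem : ∀ {w : Fin n →₀ ℕ}, toInt w ∈ G → MvPowerSeries.monomial w (1 : k) ∈ RG k G := by
    intro w hw
    rw [← algebraMap_monomial]
    exact monomial_mem_polyRG G hw 1
  have h1 : MvPowerSeries.monomial b 1 * (MvPowerSeries.monomial u 1 * g ^ p) =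
      MvPowerSeries.monomial a 1 * (MvPowerSeries.monomial v 1 * g) ^ p := by
    rw [mul_pow, MvPowerSeries.monomial_pow, ← mul_assoc, ← mul_assoc,
      MvPowerSeries.monomial_mul_monomial, MvPowerSeries.monomial_mul_monomial, hadd]
    simp
  have h2 := congrArg (algebraMap _ (K k n)) (congrArg (diagHom G) h1)
  rw [diagHom_mul G (hmem hb), diagHom_mul G (hmem ha), diagHom_pow G p hsat,
    map_mul (algebraMap _ (K k n)), map_mul (algebraMap _ (K k n)),
    ← algebraMap_monomial b, ← algebraMap_monomial a, map_pow (algebraMap _ (K k n))] at h2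
  change polyToK k n _ * _ = polyToK k n _ * _ at h2
  have hbK := polyToK_ne_zero hb0
  refine ⟨⟨polyToK k n (MvPolynomial.monomial a 1) / polyToK k n (MvPolynomial.monomial b 1),
    (mem_fracRG G).mpr ⟨_, monomial_mem_polyRG G ha 1, _, monomial_mem_polyRG G hb 1, hb0, ?_⟩⟩, ?_⟩
  · field_simp
  · rw [Subfield.smul_def, smul_eq_mul]
    rw [div_mul_eq_mul_div, ← h2]
    field_simp

end

/-- The main linear relation, over a perfect field and for a simple root `f` of `A`: any set `X`
of exponents containing the support of `A` and stable under the section operators bounds the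
`p`-degree by its number of classes modulo `G`. -/
theorem exists_relation_of_isStable (p : ℕ) [Fact p.Prime] [CharP k p] [PerfectRing k p]
    {G : AddSubgroup (Fin n → ℤ)}
    (hsat : ∀ v, p • v ∈ G → v ∈ G) {g₀ : Fin n →₀ ℕ}
    (hg₀ : toInt g₀ ∈ G) (hpos : ∀ v ∈ G, ∀ j, v j ≠ 0 → 0 < g₀ j)
    {A : (MvPolynomial (Fin n) k)[X]} {f : MvPowerSeries (Fin n) k} (hA : aeval f A = 0)
    (hder : aeval f (derivative A) ≠ 0) {X : Set ((Fin n →₀ ℕ) × ℕ)}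
    (hAX : ∀ i j, (A.coeff j).coeff i ≠ 0 → (i, j) ∈ X) (hX : IsStable p G A X)
    {Y : Finset ((Fin n →₀ ℕ) × ℕ)} {N : ℕ} (hYN : Y.card ≤ N)
    (hY : ∀ x ∈ X, ∃ y ∈ Y, y.2 = x.2 ∧ toInt x.1 - toInt y.1 ∈ G) :
    ∃ c : Fin (N + 1) → MvPolynomial (Fin n) k, (∀ s, c s ∈ polyRG G) ∧ (∃ s, c s ≠ 0) ∧
      ∑ s, algebraMap _ (MvPowerSeries (Fin n) k) (c s) * diagHom G f ^ p ^ (s : ℕ) = 0 := by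
  classical
  let κ := algebraMap (MvPowerSeries (Fin n) k) (K k n)
  have hκ : Function.Injective κ := IsFractionRing.injective _ _
  have : CharP (MvPowerSeries (Fin n) k) p :=
    charP_of_injective_algebraMap (algebraMap k (MvPowerSeries (Fin n) k)).injective p
  have : CharP (K k n) p := charP_of_injective_ringHom hκ p
  let V := residues A f X
  have hd : κ (aeval f (derivative A)) ≠ 0 := (map_ne_zero_iff _ hκ).mpr hder
  obtain ⟨t, htV, htcard, ht⟩ := exists_finset_span_of_mul_mem_span (F := fracRG (k := k) G)
    (s := κ '' V) hd (Y.image fun y => polyToK k n (MvPolynomial.monomial y.1 1) * κ f ^ y.2) (by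
      rintro _ ⟨g, hg, rfl⟩
      rw [Finset.coe_image]
      exact mul_mem_span_of_mem_residues hg₀ hpos hY hg)
  obtain ⟨t', ht'V, ht't⟩ := Finset.subset_set_image_iff.mp htV
  have hcard : (t'.image fun h => κ (diagHom G h)).card ≤ N := by
    have h1 : t'.card = t.card := by rw [← ht't, Finset.card_image_of_injective _ hκ]
    have h2 : (t'.image fun h => κ (diagHom G h)).card ≤ t'.card := Finset.card_image_le
    have h3 := htcard.trans Finset.card_image_le
    omega
  have hspan : ∀ x ∈ (fun g => κ (diagHom G g)) '' V, x ∈ Submodule.span (fracRG (k := k) G)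
      ((t'.image fun h => κ (diagHom G h) : Finset (K k n)) : Set (K k n)) := by
    rintro _ ⟨g, hg, rfl⟩
    rw [Finset.coe_image]
    refine diagHom_mem_span ?_
    have := ht _ ⟨g, hg, rfl⟩
    rwa [← ht't, Finset.coe_image] at this
  have hfrob : ∀ x ∈ (fun g => κ (diagHom G g)) '' V, x ∈ Submodule.span (fracRG (k := k) G)
      ((fun y => y ^ p) '' ((fun g => κ (diagHom G g)) '' V)) := by
    rintro _ ⟨g, hg, rfl⟩
    change κ (diagHom G g) ∈ _
    rw [eq_sum_monomial_mul_sectionOp_pow p g, map_sum, map_sum]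
    refine Submodule.sum_mem _ fun u hu => ?_
    rw [mem_box] at hu
    by_cases h : ∃ i : Fin n →₀ ℕ, toInt (u + p • i) ∈ G
    · obtain ⟨i, hi⟩ := h
      obtain ⟨v, hv⟩ := exists_sub_smul_mem p hg₀ hpos hi
      obtain ⟨c, hc⟩ := diagHom_monomial_mul_pow p hsat hg₀ hpos hv (sectionOp p u g)
      rw [hc]
      exact Submodule.smul_mem _ _ (Submodule.subset_span ⟨_, ⟨_,
        monomial_mul_sectionOp_mem_residues p hA hX hu hv hg, rfl⟩, rfl⟩)
    · push Not at h
      rw [diagHom_monomial_mul_pow_eq_zero p h, map_zero]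
      exact zero_mem _
  obtain ⟨c, hc, s₀, hs₀⟩ := exists_linear_relation_pow p hfrob hcard hspan
    ⟨f, mem_residues_self hAX, rfl⟩
  obtain ⟨b, hb, hb0, ha⟩ := exists_common_denominator G Finset.univ c
  choose! a ha hac using ha
  refine ⟨a, fun s => ha s (Finset.mem_univ s), ⟨s₀, ?_⟩, ?_⟩
  · intro h
    have h1 := hac s₀ (Finset.mem_univ s₀)
    rw [h, map_zero] at h1
    rcases mul_eq_zero.mp h1 with h2 | h2
    · exact polyToK_ne_zero hb0 h2
    · exact hs₀ (Subtype.ext h2)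
  · apply hκ
    have h1 := congrArg (polyToK k n b * ·) hc
    simp only [mul_zero, Finset.mul_sum] at h1
    rw [map_zero, map_sum, ← h1]
    refine Finset.sum_congr rfl fun s _ => ?_
    rw [map_mul, map_pow, Subfield.smul_def, smul_eq_mul, ← mul_assoc, hac s (Finset.mem_univ s)]
    rfl

end Core

/-! ### Integer points of `G_ℝ`. -/

section Lattice

variable {n : ℕ}

/-- The map `ℤᵐ → ℝᵐ`. -/
def intToReal (m : ℕ) : (Fin m → ℤ) →+ (Fin m → ℝ) where
  toFun v j := v j
  map_zero' := by ext; simp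
  map_add' a b := by ext; simp

theorem intToReal_apply {m : ℕ} (v : Fin m → ℤ) (j : Fin m) : intToReal m v j = v j := rfl

theorem intToReal_injective (m : ℕ) : Function.Injective (intToReal m) := by
  intro a b h
  ext j
  simpa [intToReal_apply] using congrFun h j

theorem intToReal_toInt (i : Fin n →₀ ℕ) : intToReal n (toInt i) = toReal i := by
  ext j
  simp [intToReal_apply, toInt, toReal]

theorem intToReal_mem_realSpan {G : AddSubgroup (Fin n → ℤ)} {v : Fin n → ℤ} (hv : v ∈ G) :
    intToReal n v ∈ realSpan G :=
  Submodule.subset_span ⟨v, hv, rfl⟩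

/-- A subgroup `G` of `ℤⁿ` with torsion-free quotient is the kernel of an integral matrix. -/
theorem exists_linearMap_of_torsionFree {G : AddSubgroup (Fin n → ℤ)}
    (hG : IsAddTorsionFree ((Fin n → ℤ) ⧸ G)) :
    ∃ (m : ℕ) (q : (Fin n → ℤ) →ₗ[ℤ] (Fin m → ℤ)) (qR : (Fin n → ℝ) →ₗ[ℝ] (Fin m → ℝ)),
      (∀ v, q v = 0 ↔ v ∈ G) ∧ (∀ v, qR (intToReal n v) = intToReal m (q v)) ∧
      ∀ x ∈ realSpan G, qR x = 0 := by
  classical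
  let π : (Fin n → ℤ) →ₗ[ℤ] ((Fin n → ℤ) ⧸ G) := (QuotientAddGroup.mk' G).toIntLinearMap
  have hπ : Function.Surjective π := QuotientAddGroup.mk'_surjective G
  have hfin : Module.Finite ℤ ((Fin n → ℤ) ⧸ G) := Module.Finite.of_surjective π hπ
  have htf : Module.IsTorsionFree ℤ ((Fin n → ℤ) ⧸ G) := inferInstance
  have hfree : Module.Free ℤ ((Fin n → ℤ) ⧸ G) := Module.free_of_finite_type_torsion_free'
  let e := (Module.finBasis ℤ ((Fin n → ℤ) ⧸ G)).equivFun
  let q := e.toLinearMap.comp π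
  have hq : ∀ v, q v = 0 ↔ v ∈ G := fun v => by
    change e (π v) = 0 ↔ _
    rw [LinearEquiv.map_eq_zero_iff]
    exact QuotientAddGroup.eq_zero_iff v
  let qR : (Fin n → ℝ) →ₗ[ℝ] (Fin _ → ℝ) := Matrix.toLin' ((LinearMap.toMatrix' q).map (↑))
  have hqR : ∀ v, qR (intToReal n v) = intToReal _ (q v) := by
    intro v
    ext j
    rw [intToReal_apply, ← LinearMap.toMatrix'_mulVec q v]
    simp [qR, Matrix.toLin'_apply, Matrix.mulVec, dotProduct, intToReal_apply]
  refine ⟨_, q, qR, hq, hqR, fun x hx => ?_⟩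
  have hle : realSpan G ≤ LinearMap.ker qR := by
    rw [realSpan, Submodule.span_le]
    rintro _ ⟨g, hg, rfl⟩
    have := hqR g
    rwa [(hq g).mpr hg, map_zero] at this
  exact hle hx

/-- An integral matrix with kernel `G` also kills `G_ℝ`. Hence integer points with the same image in
`ℝⁿ / G_ℝ` are congruent modulo `G`. -/
theorem mem_of_intToReal_mem_realSpan {G : AddSubgroup (Fin n → ℤ)}
    (hG : IsAddTorsionFree ((Fin n → ℤ) ⧸ G)) {v : Fin n → ℤ}
    (hv : intToReal n v ∈ realSpan G) : v ∈ G := by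
  obtain ⟨m, q, qR, hq, hqR, hspan⟩ := exists_linearMap_of_torsionFree hG
  rw [← hq]
  apply intToReal_injective
  rw [← hqR, hspan _ hv, map_zero]

theorem mem_of_smul_mem {G : AddSubgroup (Fin n → ℤ)}
    (hG : IsAddTorsionFree ((Fin n → ℤ) ⧸ G)) {p : ℕ} (hp : p ≠ 0) {v : Fin n → ℤ}
    (hv : p • v ∈ G) : v ∈ G := by
  apply mem_of_intToReal_mem_realSpan hG
  have h := (realSpan G).smul_mem (p : ℝ)⁻¹ (intToReal_mem_realSpan hv)
  have hp' : (p : ℝ) ≠ 0 := Nat.cast_ne_zero.mpr hp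
  rwa [map_nsmul, ← Nat.cast_smul_eq_nsmul ℝ, smul_smul, inv_mul_cancel₀ hp', one_smul] at h

end Lattice

/-! ### Newton polytopes, Ostrowski's theorem and stability of `C`. -/

section Polytope

variable {k : Type*} [Field k] {n : ℕ}

variable (n) in
/-- The point of `ℝⁿ × ℝ` attached to an exponent. -/
def pt : ((Fin n →₀ ℕ) × ℕ) →+ (Fin n → ℝ) × ℝ where
  toFun x := (toReal x.1, (x.2 : ℝ))
  map_zero' := by ext <;> simp [toReal]
  map_add' a b := by ext <;> simp [toReal]

theorem pt_apply (x : (Fin n →₀ ℕ) × ℕ) : pt n x = (toReal x.1, (x.2 : ℝ)) := rfl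

/-- The set of the exponents of `A`. -/
def expSet (A : Polynomial (MvPolynomial (Fin n) k)) : Set ((Fin n →₀ ℕ) × ℕ) :=
  {x | (A.coeff x.2).coeff x.1 ≠ 0}

theorem mem_expSet {A : Polynomial (MvPolynomial (Fin n) k)} {x : (Fin n →₀ ℕ) × ℕ} :
    x ∈ expSet A ↔ (A.coeff x.2).coeff x.1 ≠ 0 := Iff.rfl

theorem newtonPolytope_eq (A : Polynomial (MvPolynomial (Fin n) k)) :
    newtonPolytope A = convexHull ℝ (pt n '' expSet A) := by
  unfold newtonPolytope
  congr 1
  ext x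
  constructor
  · rintro ⟨i, j, h, rfl⟩
    exact ⟨(i, j), h, rfl⟩
  · rintro ⟨⟨i, j⟩, h, rfl⟩
    exact ⟨i, j, h, rfl⟩

theorem finite_expSet (A : Polynomial (MvPolynomial (Fin n) k)) : (expSet A).Finite := by
  refine (A.support.finite_toSet.biUnion fun j _ =>
    (A.coeff j).support.finite_toSet.image fun i => (i, j)).subset ?_
  rintro ⟨i, j⟩ h
  simp only [Set.mem_iUnion]
  refine ⟨j, ?_, i, ?_, rfl⟩
  · rw [Finset.mem_coe, Polynomial.mem_support_iff]
    intro h0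
    exact h (by simp [h0])
  · exact MvPolynomial.mem_support_iff.mpr h

theorem nonempty_expSet {A : Polynomial (MvPolynomial (Fin n) k)} (hA : A ≠ 0) :
    (expSet A).Nonempty := by
  obtain ⟨i, hi⟩ := MvPolynomial.ne_zero_iff.mp (Polynomial.leadingCoeff_ne_zero.mpr hA)
  exact ⟨(i, A.natDegree), hi⟩

theorem pt_mem_newtonPolytope {A : Polynomial (MvPolynomial (Fin n) k)} {x : (Fin n →₀ ℕ) × ℕ}
    (hx : x ∈ expSet A) : pt n x ∈ newtonPolytope A := by
  rw [newtonPolytope_eq]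
  exact subset_convexHull ℝ _ ⟨x, hx, rfl⟩

theorem convex_newtonPolytope (A : Polynomial (MvPolynomial (Fin n) k)) :
    Convex ℝ (newtonPolytope A) := convex_convexHull ℝ _

theorem coeff_coeff_mul_of_unique {A B : Polynomial (MvPolynomial (Fin n) k)}
    {a b : (Fin n →₀ ℕ) × ℕ} (h : ∀ a' ∈ expSet A, ∀ b' ∈ expSet B, a' + b' = a + b →
      a' = a ∧ b' = b) :
    ((A * B).coeff (a + b).2).coeff (a + b).1 =
      (A.coeff a.2).coeff a.1 * (B.coeff b.2).coeff b.1 := by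
  classical
  have key : ∀ z : ℕ × ℕ, ∀ w : (Fin n →₀ ℕ) × (Fin n →₀ ℕ), z.1 + z.2 = a.2 + b.2 →
      w.1 + w.2 = a.1 + b.1 → (A.coeff z.1).coeff w.1 * (B.coeff z.2).coeff w.2 ≠ 0 →
      z = (a.2, b.2) ∧ w = (a.1, b.1) := by
    intro z w hz hw hne
    obtain ⟨h1, h2⟩ := h (w.1, z.1) (left_ne_zero_of_mul hne) (w.2, z.2)
      (right_ne_zero_of_mul hne) (Prod.ext hw hz)
    subst h1 h2
    exact ⟨rfl, rfl⟩
  rw [Polynomial.coeff_mul, MvPolynomial.coeff_sum, Finset.sum_eq_single (a.2, b.2)]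
  · rw [MvPolynomial.coeff_mul, Finset.sum_eq_single (a.1, b.1)]
    · intro w hw hne
      by_contra h0
      exact hne (key (a.2, b.2) w rfl (Finset.HasAntidiagonal.mem_antidiagonal.mp hw) h0).2
    · intro h0
      simp at h0
  · intro z hz hne
    rw [MvPolynomial.coeff_mul]
    refine Finset.sum_eq_zero fun w hw => ?_
    by_contra h0
    exact hne (key z w (Finset.HasAntidiagonal.mem_antidiagonal.mp hz)
      (Finset.HasAntidiagonal.mem_antidiagonal.mp hw) h0).1
  · intro h0
    simp at h0

/-- The nontrivial inclusion in Ostrowski's theorem `NP(AB) = NP(A) + NP(B)`. -/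
theorem pt_add_mem_newtonPolytope_mul {A B : Polynomial (MvPolynomial (Fin n) k)}
    {x y : (Fin n →₀ ℕ) × ℕ} (hx : x ∈ expSet A) (hy : y ∈ expSet B) :
    pt n (x + y) ∈ newtonPolytope (A * B) := by
  classical
  by_contra hxy
  have hclosed : IsClosed (newtonPolytope (A * B)) := by
    rw [newtonPolytope_eq]
    exact ((finite_expSet _).image _).isClosed_convexHull ℝ
  obtain ⟨l, u, hlt, hgt⟩ := geometric_hahn_banach_closed_point (convex_newtonPolytope (A * B))
    hclosed hxy
  have hface : ∀ (Q : Polynomial (MvPolynomial (Fin n) k)), (expSet Q).Nonempty →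
      ∃ (s : Finset ((Fin n →₀ ℕ) × ℕ)) (M : ℝ), s.Nonempty ∧
        (∀ z, z ∈ s ↔ z ∈ expSet Q ∧ l (pt n z) = M) ∧ ∀ z ∈ expSet Q, l (pt n z) ≤ M := by
    intro Q hQ
    obtain ⟨z₀, hz₀, hmax⟩ := (finite_expSet Q).toFinset.exists_max_image (fun z => l (pt n z))
      (by simpa using hQ)
    rw [Set.Finite.mem_toFinset] at hz₀
    refine ⟨(finite_expSet Q).toFinset.filter fun z => l (pt n z) = l (pt n z₀), l (pt n z₀),
      ⟨z₀, by simp [hz₀]⟩, fun z => by simp, fun z hz => hmax z (by simpa using hz)⟩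
  obtain ⟨s, M, hs0, hs, hsM⟩ := hface A ⟨x, hx⟩
  obtain ⟨s', M', hs0', hs', hsM'⟩ := hface B ⟨y, hy⟩
  -- Some sum of exponents from the faces of `A` and `B` where `l` is maximal is attained only once
  -- there. Comparing values of `l`, no other exponents attain it, so its coefficient in `A * B` is
  -- nonzero.
  obtain ⟨a, ha, b, hb, huniq⟩ := UniqueSums.uniqueAdd_of_nonempty hs0 hs0'
  obtain ⟨haA, haM⟩ := (hs a).mp ha
  obtain ⟨hbB, hbM⟩ := (hs' b).mp hb
  have hab : a + b ∈ expSet (A * B) := by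
    rw [mem_expSet, coeff_coeff_mul_of_unique]
    · exact mul_ne_zero haA hbB
    · intro a' ha' b' hb' hsum
      have h1 := congrArg (fun z => l (pt n z)) hsum
      simp only [map_add, haM, hbM] at h1
      have h2 := hsM a' ha'
      have h3 := hsM' b' hb'
      exact huniq ((hs a').mpr ⟨ha', by linarith⟩) ((hs' b').mpr ⟨hb', by linarith⟩) hsum
  have h1 := hlt _ (pt_mem_newtonPolytope hab)
  rw [map_add, map_add, haM, hbM] at h1
  rw [map_add, map_add] at hgt
  have h2 := hsM x hx
  have h3 := hsM' y hy
  linarith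

/-- An exponent of `B ^ (m + 1)` is a sum of `m + 1` exponents of `B`; `s` is the average of their
translates by `w`. -/
theorem exists_smul_eq_of_mem_expSet_pow {B : Polynomial (MvPolynomial (Fin n) k)}
    {S : Set ((Fin n → ℝ) × ℝ)} (hS : Convex ℝ S) {w : (Fin n →₀ ℕ) × ℕ}
    (hB : ∀ x ∈ expSet B, pt n (x + w) ∈ S) (m : ℕ) {x : (Fin n →₀ ℕ) × ℕ}
    (hx : x ∈ expSet (B ^ (m + 1))) :
    ∃ s ∈ S, pt n (x + (m + 1) • w) = ((m : ℝ) + 1) • s := by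
  induction m generalizing x with
  | zero =>
    rw [zero_add, pow_one] at hx
    exact ⟨_, hB x hx, by simp⟩
  | succ m ih =>
    rw [pow_succ] at hx
    obtain ⟨i₁, j₁, i₂, j₂, h1, h2, h3, h4⟩ := exists_of_coeff_coeff_mul_ne_zero hx
    obtain ⟨s, hs, hs'⟩ := ih (x := (i₁, j₁)) h1
    have hx' : x + (m + 1 + 1) • w = ((i₁, j₁) + (m + 1) • w) + ((i₂, j₂) + w) := by
      rw [show x = (i₁, j₁) + (i₂, j₂) from Prod.ext h3.symm h4.symm, succ_nsmul _ (m + 1)]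
      abel
    have hm : (0 : ℝ) < (m : ℝ) + 1 := by positivity
    refine ⟨(((m : ℝ) + 1) / ((m : ℝ) + 2)) • s + (1 / ((m : ℝ) + 2)) • pt n ((i₂, j₂) + w),
      hS hs (hB _ h2) (by positivity) (by positivity) (by field_simp; ring), ?_⟩
    rw [hx', map_add, hs', smul_add, smul_smul, smul_smul]
    push_cast
    have e1 : ((m : ℝ) + 1 + 1) * (((m : ℝ) + 1) / ((m : ℝ) + 2)) = (m : ℝ) + 1 := by
      field_simp; ring
    have e2 : ((m : ℝ) + 1 + 1) * (1 / ((m : ℝ) + 2)) = 1 := by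
      field_simp; ring
    rw [e1, e2, one_smul]

/-- The exponents lying in a translate of `C` are stable under the section operators. -/
theorem pt_add_mem_convexC {G : AddSubgroup (Fin n → ℤ)}
    {A B : Polynomial (MvPolynomial (Fin n) k)} {w : (Fin n →₀ ℕ) × ℕ}
    (hB : ∀ x ∈ expSet B, pt n (x + w) ∈ newtonPolytope A) {p : ℕ} (hp : 2 ≤ p)
    {i a i' : Fin n →₀ ℕ} {j b j' : ℕ} (hij : pt n ((i, j) + w) ∈ convexC G A)
    (hab : (a, b) ∈ expSet (B ^ (p - 1))) (hi' : toInt (i + a) - p • toInt i' ∈ G)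
    (hj' : j + b = p * j' + (p - 1)) : pt n ((i', j') + w) ∈ convexC G A := by
  obtain ⟨m, rfl⟩ : ∃ m, p = m + 2 := ⟨p - 2, by omega⟩
  obtain ⟨s, hs, hs'⟩ := exists_smul_eq_of_mem_expSet_pow (convex_newtonPolytope A) hB m hab
  obtain ⟨x, hx, ⟨g, ε⟩, ⟨hg, hε⟩, hsum⟩ := Set.mem_add.mp hij
  have hr := intToReal_mem_realSpan hi'
  have hm : (0 : ℝ) < (m : ℝ) + 2 := by positivity
  -- Here `p = m + 2`. The `NP(A)` components get weights `1 / p` and `(p - 1) / p`, the `G_ℝ`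
  -- component absorbs the congruence, and the last coordinate becomes `(ε - (p - 1)) / p`, still in
  -- `(-1, 0]`.
  refine Set.mem_add.mpr ⟨((1 / ((m : ℝ) + 2)) • x + (((m : ℝ) + 1) / ((m : ℝ) + 2)) • s),
    convex_newtonPolytope A hx hs (by positivity) (by positivity) (by field_simp; ring),
    ((1 / ((m : ℝ) + 2)) • (g - intToReal n (toInt (i + a) - (m + 2) • toInt i')),
      (1 / ((m : ℝ) + 2)) * (ε - (m + 1))),
    ⟨Submodule.smul_mem _ _ (Submodule.sub_mem _ hg hr), ?_⟩, ?_⟩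
  · simp only [Set.mem_Ioc] at hε ⊢
    constructor
    · rw [one_div, inv_mul_eq_div, lt_div_iff₀ hm]
      linarith [hε.1]
    · rw [one_div, inv_mul_eq_div, div_le_iff₀ hm]
      have : (0 : ℝ) ≤ m := Nat.cast_nonneg m
      linarith [hε.2]
  · have hx' : x = pt n ((i, j) + w) - (g, ε) := eq_sub_of_add_eq hsum
    have h2 : (((m : ℝ) + 1) / ((m : ℝ) + 2)) • s =
        (1 / ((m : ℝ) + 2)) • pt n ((a, b) + (m + 1) • w) := by
      rw [hs', smul_smul]
      congr 1
      ring
    rw [h2, hx']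
    have hjR : (j : ℝ) + b = ((m : ℝ) + 2) * j' + (m + 1) := by
      have : m + 2 - 1 = m + 1 := by omega
      rw [this] at hj'
      exact_mod_cast hj'
    ext c
    · simp only [map_add, map_nsmul, pt_apply, Prod.fst_add, Prod.smul_fst, Pi.add_apply,
        Pi.smul_apply, Prod.fst_sub, Pi.sub_apply, map_sub, intToReal_apply, toInt, toReal,
        Finsupp.coe_add]
      simp only [nsmul_eq_mul, smul_eq_mul]
      push_cast
      field_simp
      ring
    · simp only [map_add, map_nsmul, pt_apply, Prod.snd_add, Prod.smul_snd, Prod.snd_sub]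
      simp only [nsmul_eq_mul, smul_eq_mul]
      push_cast
      field_simp
      linarith

end Polytope

/-! ### Finiteness of the projected set. -/

section Finiteness

variable {k : Type*} [Field k] {n : ℕ}

/-- The integral matrix with kernel `G` takes integer values at points of `ℕⁿ`, and it is bounded on
`C` because it kills `G_ℝ` and `NP(A)` is compact. Its value determines the class of an integer
point. -/
theorem finite_proj_image {G : AddSubgroup (Fin n → ℤ)}
    (hG : IsAddTorsionFree ((Fin n → ℤ) ⧸ G)) (A : Polynomial (MvPolynomial (Fin n) k)) :
    (proj G '' (convexC G A ∩ natPoints n)).Finite := by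
  classical
  obtain ⟨m, q, qR, hq, hqR, hspan⟩ := exists_linearMap_of_torsionFree hG
  let φ : ((Fin n → ℝ) × ℝ) →ₗ[ℝ] ((Fin m → ℝ) × ℝ) := LinearMap.prodMap qR LinearMap.id
  have hφ : Continuous φ := LinearMap.continuous_of_finiteDimensional φ
  have hcompact : IsCompact (newtonPolytope A) := by
    rw [newtonPolytope_eq]
    exact ((finite_expSet A).image _).isCompact_convexHull ℝ
  obtain ⟨M, hM⟩ := (hcompact.image hφ).isBounded.exists_norm_le
  have hbound : ∀ x ∈ convexC G A, ‖φ x‖ ≤ M + 1 := by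
    intro x hx
    obtain ⟨y, hy, ⟨g, ε⟩, ⟨hg, hε⟩, rfl⟩ := Set.mem_add.mp hx
    rw [map_add]
    refine (norm_add_le _ _).trans (add_le_add (hM _ ⟨y, hy, rfl⟩) ?_)
    have : φ (g, ε) = (0, ε) := Prod.ext (hspan g hg) rfl
    rw [this]
    simp only [Set.mem_Ioc] at hε
    simp only [Prod.norm_mk, norm_zero, sup_le_iff, zero_le_one, true_and, Real.norm_eq_abs]
    exact abs_le.mpr ⟨hε.1.le, by linarith [hε.2]⟩
  let ψ : (Fin m → ℤ) × ℤ → (Fin m → ℝ) × ℝ := fun z => (intToReal m z.1, (z.2 : ℝ))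
  have hfin : (φ '' (convexC G A ∩ natPoints n)).Finite := by
    let D : ℤ := ⌈M + 1⌉
    have hD : M + 1 ≤ (D : ℝ) := Int.le_ceil _
    refine (((Set.Finite.pi fun _ : Fin m => Set.finite_Icc (-D) D).prod
      (Set.finite_Icc (-D) D)).image ψ).subset ?_
    rintro _ ⟨x, ⟨hx, i, j, rfl⟩, rfl⟩
    have hφx : φ (toReal i, (j : ℝ)) = ψ (q (toInt i), (j : ℤ)) := by
      refine Prod.ext ?_ ?_
      · change qR (toReal i) = _
        rw [← intToReal_toInt, hqR]
      · simp [φ, ψ]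
    refine ⟨(q (toInt i), (j : ℤ)), ?_, hφx.symm⟩
    have hn := hbound _ hx
    rw [hφx, Prod.norm_mk, sup_le_iff] at hn
    have habs : ∀ z : ℤ, ‖(z : ℝ)‖ ≤ M + 1 → z ∈ Set.Icc (-D) D := by
      intro z hz
      rw [Real.norm_eq_abs] at hz
      have := abs_le.mp (hz.trans hD)
      exact ⟨by exact_mod_cast this.1, by exact_mod_cast this.2⟩
    refine ⟨fun c _ => habs _ ((norm_le_pi_norm (intToReal m (q (toInt i))) c).trans hn.1),
      habs _ hn.2⟩
  refine (hfin.image fun z => proj G (Function.invFunOn φ (convexC G A ∩ natPoints n) z)).subset ?_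
  rintro _ ⟨x, hx, rfl⟩
  refine ⟨φ x, ⟨x, hx, rfl⟩, ?_⟩
  have hex : ∃ a ∈ convexC G A ∩ natPoints n, φ a = φ x := ⟨x, hx, rfl⟩
  have h1 := Function.invFunOn_mem hex
  have h2 := Function.invFunOn_eq hex
  set y := Function.invFunOn φ (convexC G A ∩ natPoints n) (φ x)
  obtain ⟨-, i, j, hij⟩ := hx
  obtain ⟨-, i', j', hij'⟩ := h1
  rw [hij, hij'] at h2
  obtain ⟨h3, h4⟩ := Prod.mk.inj h2
  change proj G y = proj G x
  rw [hij, hij']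
  refine Prod.ext ?_ h4
  refine (Submodule.Quotient.eq _).mpr ?_
  change qR (toReal i') = qR (toReal i) at h3
  change toReal i' - toReal i ∈ realSpan G
  rw [← intToReal_toInt, ← intToReal_toInt] at h3 ⊢
  rw [← map_sub]
  apply intToReal_mem_realSpan
  rw [← hq]
  apply intToReal_injective
  rw [hqR, hqR] at h3
  rw [map_sub, map_sub, h3, sub_self, map_zero]

end Finiteness

/-! ### Restriction to a subset of the variables; irreducible factors. -/

section InitialForm

variable {k : Type*} [Field k] {n : ℕ}

/-- The exponent `i` vanishes outside of `J`. -/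
def SuppIn (J : Set (Fin n)) (i : Fin n →₀ ℕ) : Prop := ∀ j, j ∉ J → i j = 0

theorem SuppIn.add_iff {J : Set (Fin n)} {a b : Fin n →₀ ℕ} :
    SuppIn J (a + b) ↔ SuppIn J a ∧ SuppIn J b := by
  simp only [SuppIn, Finsupp.coe_add, Pi.add_apply, Nat.add_eq_zero_iff, ← forall_and]

open Classical in
/-- The coefficient of `t ^ b`, for `b` supported outside of `J`, of a power series seen as a
power series in the variables outside of `J`. -/
def initCoeff (J : Set (Fin n)) (b : Fin n →₀ ℕ) :
    MvPowerSeries (Fin n) k →+ MvPowerSeries (Fin n) k where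
  toFun h := fun i => if SuppIn J i then MvPowerSeries.coeff (i + b) h else 0
  map_zero' := by
    ext i
    change (if SuppIn J i then MvPowerSeries.coeff (i + b) (0 : MvPowerSeries (Fin n) k) else 0) = 0
    simp
  map_add' x y := by
    ext i
    change (if SuppIn J i then MvPowerSeries.coeff (i + b) (x + y) else 0) =
      (if SuppIn J i then MvPowerSeries.coeff (i + b) x else 0) +
        (if SuppIn J i then MvPowerSeries.coeff (i + b) y else 0)
    split_ifs <;> simp

open Classical in
theorem coeff_initCoeff (J : Set (Fin n)) (b : Fin n →₀ ℕ) (h : MvPowerSeries (Fin n) k)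
    (i : Fin n →₀ ℕ) : MvPowerSeries.coeff i (initCoeff J b h) =
      if SuppIn J i then MvPowerSeries.coeff (i + b) h else 0 := rfl

/-- Off `J`, no exponent of `h` lies strictly below `b`. A product term that equals `b` off `J` thus
comes from a term of `h` equal to `b` there and a term of `g` supported in `J`. -/
theorem initCoeff_mul {J : Set (Fin n)} {b : Fin n →₀ ℕ} (hb : SuppIn Jᶜ b)
    {h : MvPowerSeries (Fin n) k}
    (hh : ∀ x, MvPowerSeries.coeff x h ≠ 0 → (∀ j, j ∉ J → x j ≤ b j) → ∀ j, j ∉ J → x j = b j)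
    (g : MvPowerSeries (Fin n) k) :
    initCoeff J b (h * g) = initCoeff J b h * initCoeff J 0 g := by
  classical
  ext i
  rw [coeff_initCoeff, MvPowerSeries.coeff_mul, MvPowerSeries.coeff_mul]
  simp only [coeff_initCoeff, add_zero]
  split_ifs with hi
  · symm
    apply Finset.sum_of_injOn (fun z => (z.1 + b, z.2))
    · rintro ⟨z1, z2⟩ - ⟨w1, w2⟩ - hzw
      simpa using hzw
    · rintro ⟨z1, z2⟩ hz
      have hz' : z1 + z2 = i := by simpa using hz
      simp [← hz', add_right_comm]
    · rintro ⟨z1, z2⟩ hz hn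
      by_contra hne
      have hz' : z1 + z2 = i + b := by simpa using hz
      have hcoord : ∀ j, z1 j + z2 j = i j + b j := fun j => DFunLike.congr_fun hz' j
      have h1 := hh z1 (left_ne_zero_of_mul hne) fun j hj => by
        have := hcoord j
        have := hi j hj
        omega
      have hle : b ≤ z1 := by
        intro j
        by_cases hj : j ∈ J
        · rw [hb j (fun h => h hj)]; exact Nat.zero_le _
        · exact (h1 j hj).ge
      refine hn ⟨(z1 - b, z2), ?_, Prod.ext (tsub_add_cancel_of_le hle) rfl⟩
      simp only [Finset.mem_coe, Finset.HasAntidiagonal.mem_antidiagonal]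
      apply add_right_cancel (b := b)
      rw [add_right_comm, tsub_add_cancel_of_le hle, hz']
    · rintro ⟨z1, z2⟩ hz
      have hz' : z1 + z2 = i := by simpa using hz
      obtain ⟨h1, h2⟩ := SuppIn.add_iff.mp (hz' ▸ hi)
      simp [h1, h2]
  · symm
    refine Finset.sum_eq_zero fun z hz => ?_
    rw [← Finset.HasAntidiagonal.mem_antidiagonal.mp hz, SuppIn.add_iff, not_and_or] at hi
    rcases hi with hi | hi <;> simp [hi]

theorem initCoeff_zero_pow (J : Set (Fin n)) (g : MvPowerSeries (Fin n) k) (m : ℕ) :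
    initCoeff J 0 (g ^ m) = initCoeff J 0 g ^ m := by
  classical
  induction m with
  | zero =>
    ext i
    rw [pow_zero, pow_zero, coeff_initCoeff, add_zero, MvPowerSeries.coeff_one]
    by_cases hi : i = 0
    · simp [hi, SuppIn]
    · simp [hi]
  | succ m ih =>
    rw [pow_succ, initCoeff_mul (fun _ _ => rfl)
      (fun x _ h j hj => Nat.le_zero.mp (h j hj)), ih, pow_succ]

/-- If `f` is a root of `A ≠ 0`, then the restriction of `f` to the variables in `J` is a root of
a nonzero polynomial in these variables, whose exponents are exponents of `A` up to translation. -/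
theorem exists_initial_form (J : Set (Fin n)) {A : Polynomial (MvPolynomial (Fin n) k)}
    (hA : A ≠ 0) {f : MvPowerSeries (Fin n) k} (hf : Polynomial.aeval f A = 0) :
    ∃ (B : Polynomial (MvPolynomial (Fin n) k)) (w : (Fin n →₀ ℕ) × ℕ), B ≠ 0 ∧
      Polynomial.aeval (initCoeff J 0 f) B = 0 ∧
      ∀ x ∈ expSet B, SuppIn J x.1 ∧ x + w ∈ expSet A := by
  classical
  let off : (Fin n →₀ ℕ) → (Fin n →₀ ℕ) := fun i => i.filter (· ∉ J)
  have hoff₀ : ∀ i j, j ∈ J → off i j = 0 := fun i j hj =>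
    Finsupp.filter_apply_neg _ _ (not_not.mpr hj)
  have hoff₁ : ∀ i j, j ∉ J → off i j = i j := fun i j hj => Finsupp.filter_apply_pos _ _ hj
  -- Minimality is for the componentwise order on the parts off `J`; extracting `t ^ b` from `A(f) =
  -- 0` then leaves an equation for the restriction of `f`.
  obtain ⟨b, ⟨⟨x₀, hx₀, hx₀b⟩, hmin⟩⟩ := ((finite_expSet A).image fun x => off x.1).exists_minimal
    ((nonempty_expSet hA).image _)
  have hb : SuppIn Jᶜ b := by
    intro j hj
    rw [← hx₀b]
    exact hoff₀ _ _ (not_not.mp hj)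
  have hcoeff : ∀ j x, (A.coeff j).coeff x ≠ 0 → (∀ j, j ∉ J → x j ≤ b j) →
      ∀ j, j ∉ J → x j = b j := by
    intro l x hx hle j hj
    have h1 : off x ≤ b := by
      intro j
      by_cases hj : j ∈ J
      · rw [hoff₀ _ _ hj]; exact Nat.zero_le _
      · rw [hoff₁ _ _ hj]; exact hle j hj
    have h2 := hmin ⟨(x, l), hx, rfl⟩ h1 j
    exact le_antisymm (hle j hj) (h2.trans_eq (hoff₁ x j hj))
  have hpoly : ∀ j, ∃ c : MvPolynomial (Fin n) k, algebraMap _ (MvPowerSeries (Fin n) k) c =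
      initCoeff J b (algebraMap _ (MvPowerSeries (Fin n) k) (A.coeff j)) := by
    intro j
    refine exists_mvPolynomial_of_finite_support ?_
    refine ((A.coeff j).support.finite_toSet.preimage
      (add_left_injective b).injOn).subset fun i hi => ?_
    rw [Set.mem_preimage, Finset.mem_coe, MvPolynomial.mem_support_iff]
    intro h
    refine hi ?_
    rw [coeff_initCoeff, coeff_algebraMap_mvPolynomial, h, ite_self]
  choose c hc using hpoly
  let B : Polynomial (MvPolynomial (Fin n) k) :=
    ∑ j ∈ Finset.range (A.natDegree + 1), Polynomial.monomial j (c j)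
  have hBcoeff : ∀ j i, (B.coeff j).coeff i =
      if SuppIn J i then (A.coeff j).coeff (i + b) else 0 := by
    intro j i
    have h1 : (c j).coeff i = if SuppIn J i then (A.coeff j).coeff (i + b) else 0 := by
      rw [← coeff_algebraMap_mvPolynomial, hc, coeff_initCoeff, coeff_algebraMap_mvPolynomial]
    simp only [B, Polynomial.finsetSum_coeff, Polynomial.coeff_monomial, Finset.sum_ite_eq',
      Finset.mem_range]
    split_ifs at h1 ⊢ with h2 h3 h3
    · exact h1
    · exact h1
    · rw [Polynomial.coeff_eq_zero_of_natDegree_lt (by omega)]; rfl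
    · rfl
  refine ⟨B, (b, 0), ?_, ?_, ?_⟩
  · intro h
    have h1 := hBcoeff x₀.2 (x₀.1.filter (· ∈ J))
    have h2 : SuppIn J (x₀.1.filter (· ∈ J)) := fun j hj => Finsupp.filter_apply_neg _ _ hj
    rw [if_pos h2, ← hx₀b, Finsupp.filter_add_filter_not, h] at h1
    exact hx₀ (by simpa using h1.symm)
  · have h1 := congrArg (initCoeff J b) hf
    rw [map_zero, Polynomial.aeval_eq_sum_range, map_sum] at h1
    rw [← h1, map_sum]
    refine Finset.sum_congr rfl fun j _ => ?_
    rw [Polynomial.aeval_monomial, hc, Algebra.smul_def, initCoeff_mul hb, initCoeff_zero_pow]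
    intro x hx
    rw [coeff_algebraMap_mvPolynomial] at hx
    exact hcoeff j x hx
  · intro x hx
    rw [mem_expSet, hBcoeff] at hx
    split_ifs at hx with h
    · exact ⟨h, hx⟩
    · exact absurd rfl hx

theorem exists_irreducible_factor_of_root {R S : Type*} [CommRing R] [IsDomain R]
    [UniqueFactorizationMonoid R] [CommRing S] [IsDomain S] (φ : R →+* S) {a : R} (ha : a ≠ 0)
    (h : φ a = 0) : ∃ q b, Irreducible q ∧ a = q * b ∧ φ q = 0 := by
  obtain ⟨s, hs, hsa⟩ := WfDvdMonoid.exists_factors a ha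
  have h0 : (s.map φ).prod = 0 := by
    rw [Multiset.prod_hom]
    obtain ⟨u, rfl⟩ := hsa
    rw [map_mul] at h
    exact (mul_eq_zero.mp h).resolve_right (u.isUnit.map φ).ne_zero
  rw [Multiset.prod_eq_zero_iff, Multiset.mem_map] at h0
  obtain ⟨q, hq, hq0⟩ := h0
  obtain ⟨b, hb⟩ := (Multiset.dvd_prod hq).trans hsa.dvd
  exact ⟨q, b, hs q hq, hb, hq0⟩

end InitialForm

/-! ### Reduction to a simple root, over a perfect field. -/

section PerfectField

variable {k : Type*} [Field k] {n : ℕ}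

/-- Sum, over the coordinates `j`, one element of `G ∩ ℕⁿ` that is nonzero at `j`, when there is
one; nonnegativity prevents cancellation. -/
theorem exists_maximal_support (G : AddSubgroup (Fin n → ℤ)) :
    ∃ g₀ : Fin n →₀ ℕ, toInt g₀ ∈ G ∧ ∀ i : Fin n →₀ ℕ, toInt i ∈ G → ∀ j, i j ≠ 0 → g₀ j ≠ 0 := by
  classical
  have : ∀ j, ∃ e : Fin n →₀ ℕ, toInt e ∈ G ∧
      ∀ i : Fin n →₀ ℕ, toInt i ∈ G → i j ≠ 0 → e j ≠ 0 := by
    intro j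
    by_cases h : ∃ i : Fin n →₀ ℕ, toInt i ∈ G ∧ i j ≠ 0
    · obtain ⟨i, hi, hij⟩ := h
      exact ⟨i, hi, fun _ _ _ => hij⟩
    · push Not at h
      exact ⟨0, by rw [toInt_zero]; exact G.zero_mem, fun i hi hij => absurd (h i hi) hij⟩
  choose e he he' using this
  have hsum : ∀ s : Finset (Fin n), toInt (∑ j ∈ s, e j) ∈ G := by
    intro s
    induction s using Finset.induction_on with
    | empty => rw [Finset.sum_empty, toInt_zero]; exact G.zero_mem
    | insert j s hj ih => rw [Finset.sum_insert hj, toInt_add]; exact G.add_mem (he j) ih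
  refine ⟨∑ j, e j, hsum _, fun i hi j hij h0 => he' j i hi hij ?_⟩
  rw [Finsupp.finsetSum_apply, Finset.sum_eq_zero_iff] at h0
  exact h0 j (Finset.mem_univ j)

/-- The elements of `G` that vanish outside of `J`. -/
def restrictSubgroup (G : AddSubgroup (Fin n → ℤ)) (J : Set (Fin n)) :
    AddSubgroup (Fin n → ℤ) where
  carrier := {v | v ∈ G ∧ ∀ j, j ∉ J → v j = 0}
  add_mem' := fun ⟨ha, ha'⟩ ⟨hb, hb'⟩ =>
    ⟨G.add_mem ha hb, fun j hj => by rw [Pi.add_apply, ha' j hj, hb' j hj, add_zero]⟩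
  zero_mem' := ⟨G.zero_mem, fun _ _ => rfl⟩
  neg_mem' := fun ⟨ha, ha'⟩ =>
    ⟨G.neg_mem ha, fun j hj => by rw [Pi.neg_apply, ha' j hj, neg_zero]⟩

theorem newtonPolytope_add_pt_subset {A B : Polynomial (MvPolynomial (Fin n) k)}
    {w : (Fin n →₀ ℕ) × ℕ} (h : ∀ x ∈ expSet B, x + w ∈ expSet A) {y : (Fin n → ℝ) × ℝ}
    (hy : y ∈ newtonPolytope B) : y + pt n w ∈ newtonPolytope A := by
  rw [newtonPolytope_eq] at hy
  refine convexHull_min ?_ ((convex_newtonPolytope A).translate_preimage_left (pt n w)) hy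
  rintro _ ⟨x, hx, rfl⟩
  rw [Set.mem_preimage, ← map_add]
  exact pt_mem_newtonPolytope (h x hx)

theorem convex_suppIn (J : Set (Fin n)) :
    Convex ℝ {y : (Fin n → ℝ) × ℝ | ∀ j, j ∉ J → y.1 j = 0} := by
  intro x hx y hy a b _ _ _ j hj
  simp [hx j hj, hy j hj]

theorem newtonPolytope_subset_convexC (G : AddSubgroup (Fin n → ℤ))
    (A : Polynomial (MvPolynomial (Fin n) k)) : newtonPolytope A ⊆ convexC G A := fun x hx =>
  Set.mem_add.mpr ⟨x, hx, 0, ⟨Submodule.zero_mem _, by simp⟩, add_zero x⟩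

/-- The linear relation between iterated `p`-th powers of the diagonal, over a perfect field. -/
theorem exists_relation_of_perfect (p : ℕ) [Fact p.Prime] [CharP k p] [PerfectRing k p]
    {G : AddSubgroup (Fin n → ℤ)} (hG : IsAddTorsionFree ((Fin n → ℤ) ⧸ G))
    {A : Polynomial (MvPolynomial (Fin n) k)} (hA : A ≠ 0)
    {f : MvPowerSeries (Fin n) k} (hf : Polynomial.aeval f A = 0) :
    ∃ c : Fin ((proj G '' (convexC G A ∩ natPoints n)).ncard + 1) → MvPolynomial (Fin n) k,
      (∀ s, c s ∈ polyRG G) ∧ (∃ s, c s ≠ 0) ∧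
      ∑ s, algebraMap _ (MvPowerSeries (Fin n) k) (c s) * diagHom G f ^ p ^ (s : ℕ) = 0 := by
  classical
  have hp : p.Prime := Fact.out
  obtain ⟨g₀, hg₀, hmax⟩ := exists_maximal_support G
  -- All of `G ∩ ℕⁿ` is supported in `J`, so the diagonal only sees the variables in `J`; for the
  -- elements of `G` supported there, `g₀` has the required positivity.
  let J : Set (Fin n) := {j | g₀ j ≠ 0}
  let G' := restrictSubgroup G J
  have hsat : ∀ v, p • v ∈ G' → v ∈ G' := by
    rintro v ⟨hv, hv'⟩
    refine ⟨mem_of_smul_mem hG hp.ne_zero hv, fun j hj => ?_⟩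
    have := hv' j hj
    rw [Pi.smul_apply, smul_eq_zero] at this
    exact this.resolve_left hp.ne_zero
  have hg₀' : toInt g₀ ∈ G' := ⟨hg₀, fun j hj => by
    simpa [J, toInt] using hj⟩
  have hpos : ∀ v ∈ G', ∀ j, v j ≠ 0 → 0 < g₀ j := by
    intro v hv j hj
    by_contra h
    exact hj (hv.2 j fun hJ => hJ (Nat.eq_zero_of_not_pos h))
  have hmem : ∀ i : Fin n →₀ ℕ, toInt i ∈ G ↔ toInt i ∈ G' ∧ SuppIn J i := by
    intro i
    refine ⟨fun hi => ?_, fun hi => hi.1.1⟩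
    have hJ : SuppIn J i := fun j hj => by
      by_contra h
      exact hj (hmax i hi j h)
    exact ⟨⟨hi, fun j hj => by simp [toInt, hJ j hj]⟩, hJ⟩
  have hdiag : diagHom G f = diagHom G' (initCoeff J 0 f) := by
    ext i
    rw [coeff_diagHom, coeff_diagHom, coeff_initCoeff, add_zero, hmem]
    by_cases h1 : toInt i ∈ G' <;> simp [h1]
  obtain ⟨A₀, w₁, hA₀, hA₀f, hA₀w⟩ := exists_initial_form J hA hf
  obtain ⟨A₁, B, hirr, hAB, hA₁f⟩ := exists_irreducible_factor_of_root
    (Polynomial.aeval (initCoeff J 0 f) :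
      Polynomial (MvPolynomial (Fin n) k) →ₐ[MvPolynomial (Fin n) k] _).toRingHom hA₀ hA₀f
  have hB0 : B ≠ 0 := by
    rintro rfl
    exact hA₀ (by rw [hAB, mul_zero])
  -- Any exponent of the cofactor `B` serves to translate the exponents of `A₁` into `NP(A₀)`; `w₁`
  -- then translates them into `NP(A)`.
  obtain ⟨v, hv⟩ := nonempty_expSet hB0
  have hder := aeval_derivative_ne_zero_of_irreducible p hirr hA₁f
  have hNP : ∀ x ∈ expSet A₁, pt n (x + v) ∈ newtonPolytope A₀ := fun x hx => by
    rw [hAB]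
    exact pt_add_mem_newtonPolytope_mul hx hv
  have hNP' : ∀ x ∈ expSet A₁, pt n (x + (v + w₁)) ∈ newtonPolytope A := fun x hx => by
    rw [← add_assoc, map_add]
    exact newtonPolytope_add_pt_subset (fun y hy => (hA₀w y hy).2) (hNP x hx)
  have hJA₁ : ∀ x ∈ expSet A₁, SuppIn J x.1 := by
    intro x hx j hj
    have h1 := hNP x hx
    rw [newtonPolytope_eq] at h1
    have h2 := convexHull_min (t := {y : (Fin n → ℝ) × ℝ | ∀ j, j ∉ J → y.1 j = 0}) (by
      rintro _ ⟨y, hy, rfl⟩ j hj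
      simp [pt_apply, toReal, (hA₀w y hy).1 j hj]) (convex_suppIn J) h1 j hj
    have h3 : ((x.1 j : ℝ) + v.1 j) = 0 := by simpa [pt_apply, toReal] using h2
    have h4 : x.1 j + v.1 j = 0 := by exact_mod_cast h3
    omega
  set w := v + w₁
  let X : Set ((Fin n →₀ ℕ) × ℕ) := {x | SuppIn J x.1 ∧ pt n (x + w) ∈ convexC G A}
  have hAX : ∀ i j, (A₁.coeff j).coeff i ≠ 0 → (i, j) ∈ X := fun i j h =>
    ⟨hJA₁ (i, j) h, newtonPolytope_subset_convexC G A (hNP' (i, j) h)⟩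
  have hX : IsStable p G' A₁ X := by
    rintro i j a b i' j' ⟨hi, hij⟩ hab hi' hj'
    refine ⟨fun l hl => ?_, pt_add_mem_convexC hNP' hp.two_le hij hab hi'.1 hj'⟩
    obtain ⟨m, hm⟩ : ∃ m, p - 1 = m + 1 := ⟨p - 2, by have := hp.two_le; omega⟩
    obtain ⟨s, hs, hs'⟩ := exists_smul_eq_of_mem_expSet_pow (convex_suppIn J) (w := 0)
      (B := A₁) (fun x hx j hj => by simp [pt_apply, toReal, hJA₁ x hx j hj]) m
      (x := (a, b)) (by rw [← hm]; exact hab)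
    have ha : a l = 0 := by
      have h1 := congrArg (fun y : (Fin n → ℝ) × ℝ => y.1 l) hs'
      simpa [pt_apply, toReal, hs l hl] using h1
    have h2 := hi'.2 l hl
    have h3 : (i l : ℤ) + a l - p * i' l = 0 := by simpa [toInt] using h2
    rw [hi l hl, ha] at h3
    have h4 : (p : ℤ) * i' l = 0 := by simpa using h3
    have h5 : p * i' l = 0 := by exact_mod_cast h4
    exact (mul_eq_zero.mp h5).resolve_left hp.ne_zero
  have hfin := finite_proj_image hG A
  let ρ : (Fin n →₀ ℕ) × ℕ → ((Fin n → ℝ) ⧸ realSpan G) × ℝ := fun x => proj G (pt n (x + w))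
  -- One representative per projected point. Points not reached from `X` give an arbitrary default,
  -- harmless since only an upper bound on the cardinality is needed.
  let Y := hfin.toFinset.image (Function.invFunOn ρ X)
  have hYN : Y.card ≤ (proj G '' (convexC G A ∩ natPoints n)).ncard := by
    rw [Set.ncard_eq_toFinset_card _ hfin]
    exact Finset.card_image_le
  have hY : ∀ x ∈ X, ∃ y ∈ Y, y.2 = x.2 ∧ toInt x.1 - toInt y.1 ∈ G' := by
    intro x hx
    have hex : ∃ a ∈ X, ρ a = ρ x := ⟨x, hx, rfl⟩
    refine ⟨Function.invFunOn ρ X (ρ x), Finset.mem_image_of_mem _ ?_, ?_⟩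
    · rw [Set.Finite.mem_toFinset]
      exact ⟨_, ⟨hx.2, _, _, rfl⟩, rfl⟩
    have h1 := Function.invFunOn_mem hex
    have h2 := Function.invFunOn_eq hex
    set y := Function.invFunOn ρ X (ρ x)
    obtain ⟨h3, h4⟩ := Prod.mk.inj h2
    constructor
    · have h5 : ((y.2 : ℝ) + w.2) = x.2 + w.2 := by simpa [pt_apply] using h4
      exact_mod_cast add_right_cancel h5
    · refine ⟨mem_of_intToReal_mem_realSpan hG ?_, fun j hj => ?_⟩
      · have h5 := (Submodule.Quotient.eq _).mp h3.symm
        change toReal (x.1 + w.1) - toReal (y.1 + w.1) ∈ realSpan G at h5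
        rw [← intToReal_toInt, ← intToReal_toInt, ← map_sub, toInt_add, toInt_add,
          add_sub_add_right_eq_sub] at h5
        exact h5
      · simp [toInt, hx.1 j hj, h1.1 j hj]
  obtain ⟨c, hc, hc0, hrel⟩ := exists_relation_of_isStable p hsat hg₀' hpos hA₁f hder hAX hX hYN hY
  refine ⟨c, fun s => ?_, hc0, ?_⟩
  · rw [mem_polyRG]
    exact fun i hi => ((mem_polyRG G').mp (hc s) i hi).1
  · rw [hdiag]
    exact hrel

end PerfectField

/-! ### Descent from the algebraic closure. -/

section Descent

variable {k k' : Type*} [Field k] [Field k'] [Algebra k k'] {n : ℕ}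

theorem coeff_coeff_map (A : Polynomial (MvPolynomial (Fin n) k)) (i : Fin n →₀ ℕ) (j : ℕ) :
    ((A.map (MvPolynomial.map (algebraMap k k'))).coeff j).coeff i =
      algebraMap k k' ((A.coeff j).coeff i) := by
  rw [Polynomial.coeff_map, MvPolynomial.coeff_map]

theorem convexC_map (G : AddSubgroup (Fin n → ℤ)) (A : Polynomial (MvPolynomial (Fin n) k)) :
    convexC G (A.map (MvPolynomial.map (algebraMap k k'))) = convexC G A := by
  have : expSet (A.map (MvPolynomial.map (algebraMap k k'))) = expSet A := by
    ext x
    rw [mem_expSet, mem_expSet, coeff_coeff_map, map_ne_zero]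
  rw [convexC, convexC, newtonPolytope_eq, newtonPolytope_eq, this]

theorem aeval_map_eq_map_aeval (A : Polynomial (MvPolynomial (Fin n) k))
    (f : MvPowerSeries (Fin n) k) :
    Polynomial.aeval (MvPowerSeries.map (algebraMap k k') f)
      (A.map (MvPolynomial.map (algebraMap k k'))) =
      MvPowerSeries.map (algebraMap k k') (Polynomial.aeval f A) := by
  rw [Polynomial.aeval_def, Polynomial.aeval_def, Polynomial.eval₂_map, Polynomial.hom_eval₂]
  congr 1

theorem diagHom_map (G : AddSubgroup (Fin n → ℤ)) (f : MvPowerSeries (Fin n) k) :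
    diagHom G (MvPowerSeries.map (algebraMap k k') f) =
      MvPowerSeries.map (algebraMap k k') (diagHom G f) := by
  classical
  ext i
  rw [coeff_diagHom, MvPowerSeries.coeff_map, MvPowerSeries.coeff_map, coeff_diagHom]
  split_ifs <;> simp

/-- A linear form applied to the coefficients of a power series. -/
def mapCoeff (φ : k' →ₗ[k] k) : MvPowerSeries (Fin n) k' →+ MvPowerSeries (Fin n) k where
  toFun h := fun i => φ (MvPowerSeries.coeff i h)
  map_zero' := by
    ext i
    change φ (MvPowerSeries.coeff i 0) = 0
    simp
  map_add' a b := by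
    ext i
    change φ (MvPowerSeries.coeff i (a + b)) =
      φ (MvPowerSeries.coeff i a) + φ (MvPowerSeries.coeff i b)
    simp

theorem coeff_mapCoeff (φ : k' →ₗ[k] k) (h : MvPowerSeries (Fin n) k') (i : Fin n →₀ ℕ) :
    MvPowerSeries.coeff i (mapCoeff φ h) = φ (MvPowerSeries.coeff i h) := rfl

/-- Each coefficient of the second factor is a scalar of `k`, through which `φ` is linear. -/
theorem mapCoeff_mul_map (φ : k' →ₗ[k] k) (h : MvPowerSeries (Fin n) k')
    (g : MvPowerSeries (Fin n) k) :
    mapCoeff φ (h * MvPowerSeries.map (algebraMap k k') g) = mapCoeff φ h * g := by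
  classical
  ext i
  rw [coeff_mapCoeff, MvPowerSeries.coeff_mul, MvPowerSeries.coeff_mul, map_sum]
  refine Finset.sum_congr rfl fun z _ => ?_
  rw [MvPowerSeries.coeff_map, coeff_mapCoeff, mul_comm, ← Algebra.smul_def, map_smul,
    smul_eq_mul, mul_comm]

/-- Linear relations descend along extensions of the field of coefficients. -/
theorem exists_relation_descent {G : AddSubgroup (Fin n → ℤ)} {N : ℕ}
    {g : Fin (N + 1) → MvPowerSeries (Fin n) k} {c : Fin (N + 1) → MvPolynomial (Fin n) k'}
    (hc : ∀ s, c s ∈ polyRG G) (hc0 : ∃ s, c s ≠ 0)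
    (hrel : ∑ s, algebraMap _ (MvPowerSeries (Fin n) k') (c s) *
      MvPowerSeries.map (algebraMap k k') (g s) = 0) :
    ∃ c : Fin (N + 1) → MvPolynomial (Fin n) k, (∀ s, c s ∈ polyRG G) ∧ (∃ s, c s ≠ 0) ∧
      ∑ s, algebraMap _ (MvPowerSeries (Fin n) k) (c s) * g s = 0 := by
  obtain ⟨s₀, hs₀⟩ := hc0
  obtain ⟨i₀, hi₀⟩ := MvPolynomial.ne_zero_iff.mp hs₀
  -- A linear form that is nonzero on one coefficient of the relation keeps the descended relation
  -- nontrivial.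
  obtain ⟨φ, hφ⟩ : ∃ φ : Module.Dual k k', φ ((c s₀).coeff i₀) ≠ 0 := by
    by_contra h
    push Not at h
    exact hi₀ ((Module.forall_dual_apply_eq_zero_iff k _).mp h)
  have hpoly : ∀ s, ∃ d : MvPolynomial (Fin n) k, algebraMap _ (MvPowerSeries (Fin n) k) d =
      mapCoeff φ (algebraMap _ (MvPowerSeries (Fin n) k') (c s)) := by
    intro s
    refine exists_mvPolynomial_of_finite_support ?_
    refine (c s).support.finite_toSet.subset fun i hi => ?_
    rw [Finset.mem_coe, MvPolynomial.mem_support_iff]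
    intro h
    refine hi ?_
    rw [coeff_mapCoeff, coeff_algebraMap_mvPolynomial, h, map_zero]
  choose d hd using hpoly
  have hdc : ∀ s i, (d s).coeff i = φ ((c s).coeff i) := fun s i => by
    rw [← coeff_algebraMap_mvPolynomial, hd, coeff_mapCoeff, coeff_algebraMap_mvPolynomial]
  refine ⟨d, fun s => (mem_polyRG G).mpr fun i hi => (mem_polyRG G).mp (hc s) i fun h => hi ?_,
    ⟨s₀, fun h => hφ ?_⟩, ?_⟩
  · rw [hdc, h, map_zero]
  · rw [← hdc, h, MvPolynomial.coeff_zero]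
  · have h1 := congrArg (mapCoeff φ) hrel
    rw [map_zero, map_sum] at h1
    rw [← h1]
    exact Finset.sum_congr rfl fun s _ => by rw [mapCoeff_mul_map, hd]

/-- The linear relation between iterated `p`-th powers of the diagonal. -/
theorem exists_relation (p : ℕ) [Fact p.Prime] [CharP k p]
    {G : AddSubgroup (Fin n → ℤ)} (hG : IsAddTorsionFree ((Fin n → ℤ) ⧸ G))
    {A : Polynomial (MvPolynomial (Fin n) k)} (hA : A ≠ 0)
    {f : MvPowerSeries (Fin n) k} (hf : Polynomial.aeval f A = 0) :
    ∃ c : Fin ((proj G '' (convexC G A ∩ natPoints n)).ncard + 1) → MvPolynomial (Fin n) k,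
      (∀ s, c s ∈ polyRG G) ∧ (∃ s, c s ≠ 0) ∧
      ∑ s, algebraMap _ (MvPowerSeries (Fin n) k) (c s) * diagHom G f ^ p ^ (s : ℕ) = 0 := by
  have : CharP (AlgebraicClosure k) p :=
    charP_of_injective_algebraMap (algebraMap k (AlgebraicClosure k)).injective p
  have : PerfectRing (AlgebraicClosure k) p := PerfectField.toPerfectRing p
  have hinj : Function.Injective
      (MvPolynomial.map (σ := Fin n) (algebraMap k (AlgebraicClosure k))) :=
    MvPolynomial.map_injective _ (algebraMap k (AlgebraicClosure k)).injective
  have hA' := (Polynomial.map_ne_zero_iff hinj).mpr hA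
  have hf' : Polynomial.aeval (MvPowerSeries.map (algebraMap k (AlgebraicClosure k)) f)
      (A.map (MvPolynomial.map (algebraMap k (AlgebraicClosure k)))) = 0 := by
    rw [aeval_map_eq_map_aeval, hf, map_zero]
  have h := exists_relation_of_perfect p hG hA' hf'
  rw [convexC_map] at h
  obtain ⟨c, hc, hc0, hrel⟩ := h
  refine exists_relation_descent hc hc0 ?_
  rw [← hrel]
  exact Finset.sum_congr rfl fun s _ => by rw [diagHom_map, map_pow]

end Descent

/-! ### From the linear relation to a linearized polynomial. -/

section Linearized

variable {k : Type*} [Field k] {n : ℕ}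

theorem laurentMonomial_toInt (i : Fin n →₀ ℕ) :
    laurentMonomial k (toInt i) =
      algebraMap (MvPolynomial (Fin n) k) (K0 k n) (MvPolynomial.monomial i 1) := by
  rw [MvPolynomial.monomial_eq, map_one, one_mul, Finsupp.prod_fintype _ _ (by simp), map_prod]
  simp [laurentMonomial, toInt]

theorem algebraMap_mem_K0G {G : AddSubgroup (Fin n → ℤ)} {a : MvPolynomial (Fin n) k}
    (ha : a ∈ polyRG G) : algebraMap (MvPolynomial (Fin n) k) (K0 k n) a ∈ K0G k G := by
  rw [MvPolynomial.as_sum a, map_sum]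
  refine sum_mem fun i hi => ?_
  have hi' := (mem_polyRG G).mp ha i (MvPolynomial.mem_support_iff.mp hi)
  have : MvPolynomial.monomial i (MvPolynomial.coeff i a) =
      MvPolynomial.coeff i a • MvPolynomial.monomial i (1 : k) := by
    rw [MvPolynomial.smul_monomial, smul_eq_mul, mul_one]
  rw [this, Algebra.algebraMap_eq_smul_one, smul_assoc, ← Algebra.algebraMap_eq_smul_one,
    ← laurentMonomial_toInt]
  exact (K0G k G).smul_mem (IntermediateField.subset_adjoin k _ ⟨_, hi', rfl⟩)

theorem exists_isLinearized_of_relation (p : ℕ) {G : AddSubgroup (Fin n → ℤ)}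
    {f : MvPowerSeries (Fin n) k} {N : ℕ} {c : Fin (N + 1) → MvPolynomial (Fin n) k}
    (hc : ∀ s, c s ∈ polyRG G) (hc0 : ∃ s, c s ≠ 0)
    (hrel : ∑ s, algebraMap _ (MvPowerSeries (Fin n) k) (c s) * diagHom G f ^ p ^ (s : ℕ) = 0) :
    ∃ (d : ℕ) (P : Polynomial (K0G k G)), d ≤ N ∧ IsLinearized p P d ∧
      P.eval₂ ((inclusionK0 k n).comp (algebraMap (K0G k G) (K0 k n)))
        (algebraMap (MvPowerSeries (Fin n) k) (K k n)
          (diagonal k G f : MvPowerSeries (Fin n) k)) = 0 := by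
  classical
  obtain ⟨s₀, hs₀⟩ := hc0
  -- The `p`-degree is the largest index with a nonzero coefficient, possibly smaller than `N`.
  obtain ⟨d, hd, hmax⟩ := (Finset.univ.filter fun s => c s ≠ 0).exists_max_image
    (fun s => (s : ℕ)) ⟨s₀, by simpa using hs₀⟩
  have hd0 : c d ≠ 0 := (Finset.mem_filter.mp hd).2
  let e : ℕ → MvPolynomial (Fin n) k := fun s => if h : s < N + 1 then c ⟨s, h⟩ else 0
  have he : ∀ s : Fin (N + 1), e s = c s := fun s => dif_pos s.2
  have hemem : ∀ s, e s ∈ polyRG G := by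
    intro s
    by_cases h : s < N + 1
    · rw [show e s = c ⟨s, h⟩ from dif_pos h]
      exact hc _
    · rw [show e s = 0 from dif_neg h]
      exact zero_mem _
  have hezero : ∀ s, (d : ℕ) < s → e s = 0 := by
    intro s hs
    by_cases h : s < N + 1
    · rw [show e s = c ⟨s, h⟩ from dif_pos h]
      by_contra h0
      have h1 := hmax ⟨s, h⟩ (by simpa using h0)
      exact absurd hs (not_lt.mpr h1)
    · exact dif_neg h
  let b : ℕ → K0G k G := fun s =>
    ⟨algebraMap _ (K0 k n) (e s), algebraMap_mem_K0G (hemem s)⟩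
  refine ⟨d, ∑ s ∈ Finset.range ((d : ℕ) + 1), Polynomial.C (b s) * Polynomial.X ^ (p ^ s),
    Nat.lt_succ_iff.mp d.2, ⟨b, ?_, rfl⟩, ?_⟩
  · intro h
    have h1 : algebraMap _ (K0 k n) (e d) = 0 := congrArg Subtype.val h
    rw [map_eq_zero_iff _ (IsFractionRing.injective (MvPolynomial (Fin n) k) (K0 k n)),
      he] at h1
    exact hd0 h1
  · rw [Polynomial.eval₂_finsetSum]
    have h1 : ∀ s, Polynomial.eval₂ ((inclusionK0 k n).comp
        (algebraMap (K0G k G) (K0 k n)))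
        (algebraMap (MvPowerSeries (Fin n) k) (K k n)
          (diagonal k G f : MvPowerSeries (Fin n) k))
        (Polynomial.C (b s) * Polynomial.X ^ (p ^ s)) =
        algebraMap (MvPowerSeries (Fin n) k) (K k n)
          (algebraMap _ (MvPowerSeries (Fin n) k) (e s) * diagHom G f ^ p ^ s) := by
      intro s
      rw [Polynomial.eval₂_mul, Polynomial.eval₂_C, Polynomial.eval₂_X_pow, map_mul, map_pow,
        ← inclusionK0_algebraMap]
      rfl
    simp only [h1]
    rw [← map_sum, Finset.sum_subset (s₂ := Finset.range (N + 1)), Finset.sum_range]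
    · simp only [he]
      rw [hrel, map_zero]
    · exact Finset.range_mono d.2
    · intro s _ hs
      rw [hezero s (by simpa using hs), map_zero, zero_mul]

end Linearized

end GenDiag
end

theorem theorem3p2 {p : ℕ} (hp : p.Prime) {k : Type*} [Field k] [CharP k p] {n : ℕ}
    (G : AddSubgroup (Fin n → ℤ)) (hG : IsAddTorsionFree ((Fin n → ℤ) ⧸ G))
    (A : Polynomial (MvPolynomial (Fin n) k)) (hA : A ≠ 0)
    (f : MvPowerSeries (Fin n) k) (hf : Polynomial.aeval f A = 0) :
    (GenDiag.proj G '' (GenDiag.convexC G A ∩ GenDiag.natPoints n)).Finite ∧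
    ∃ (d : ℕ) (P : Polynomial (GenDiag.K0G k G)),
      d ≤ (GenDiag.proj G '' (GenDiag.convexC G A ∩ GenDiag.natPoints n)).ncard ∧
      GenDiag.IsLinearized p P d ∧
      P.eval₂ ((GenDiag.inclusionK0 k n).comp (algebraMap (GenDiag.K0G k G) (GenDiag.K0 k n)))
        (algebraMap (MvPowerSeries (Fin n) k) (GenDiag.K k n)
          (GenDiag.diagonal k G f : MvPowerSeries (Fin n) k)) = 0 := by
  have : Fact p.Prime := ⟨hp⟩
  obtain ⟨c, hc, hc0, hrel⟩ := GenDiag.exists_relation p hG hA hf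
  exact ⟨GenDiag.finite_proj_image hG A, GenDiag.exists_isLinearized_of_relation p hc hc0 hrel⟩
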